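/- Let $n\in\mathbb N$ and let $K\subset\mathbb R^n$ be an open convex cone, invariant under permutations of the coordinates, with $\{\kappa:\kappa_i\ge 0\ \forall i\}\subset\overline K$. Let $f$ be a real function, differentiable on $K$, symmetric, concave, positive and homogeneous of degree one on $K$, with $\partial f/\partial\kappa_i>0$ on $K$ for every $i$. For a $C^2$ hypersurface $\Gamma\subset\mathbb R^{n+1}$ which bounds an open set $U$ (lying locally on one side of $\Gamma$), with principal curvatures $\kappa$ taken with respect to the inner normal $\nu$ (nonnegative for convex $U$), write $F(A[\Gamma])=f(\kappa)$ wherever $\kappa\in K$. Given $\delta>0$, say that $\partial U$ satisfies the $\delta$-Andrews condition at a boundary point $x$ if $\partial U$ is a $C^2$ hypersurface near $x$ with $U$ on one side of it, $\kappa(x)\in K$, and, with $F_x=F(A[\partial U])(x)$ and $r=\delta/F_x$, the open ball of radius $r$ centred at $x+r\nu_x$ (the ball of radius $r$ tangent to $\partial U$ at $x$ from inside) is contained in $U$. Let $\Omega\subset\mathbb R^{n+1}$ be a bounded open set whose boundary $\partial\Omega$ satisfies the $\delta$-Andrews condition at each of its points (in particular $\partial\Omega$ is of class $C^2$). Let $u$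 be a classical solution of $$|\nabla u|\,F(A[\Gamma_t])=1\ \text{ in }\Omega,\qquad u=0\ \text{ on }\partial\Omega,\qquad \Gamma_t=\{x\in\Omega: u(x)=-t\},$$ in the following sense: $u$ is defined on $\mathbb R^{n+1}$ and is differentiable at every point of $\overline\Omega$, with $\nabla u$ Lipschitz on $\overline\Omega$; it is smooth ($C^\infty$) at every point of $\overline\Omega$ where $\nabla u\ne0$ (boundary points included); the points of $\Omega$ with $\nabla u\neq 0$ are dense in $\Omega$; at every such point the principal curvatures $\kappa$ of the level set of $u$, with respect to the normal $-\nabla u/|\nabla u|$, lie in $K$ and satisfy $|\nabla u|\,f(\kappa)=1$; and $u=0$ on $\partial\Omega$. Then every level set of $u$ satisfies the $\delta$-Andrews condition: for every $t$ and every $x\in\Gamma_t$ such that $\nabla u(x)\ne0$, or such that the boundary of $\Omega_t=\{y\in\Omega:u(y)<-t\}$ is a $C^2$ hypersurface near $x$ with $\Omega_t$ on one side of it and $x\in\partial\Omega_t$, the boundary of $\Omega_t$ satisfies the $\delta$-Andrews condition at $x$. -/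

import Mathlib

open scoped ContDiff

/-- The structure conditions on a curvature function `f`, a function of the `n` principal curvatures
defined on the admissible cone `K`: `K` is an open symmetric convex cone whose closure contains the
closed positive orthant, and `f` is symmetric, strictly increasing in each variable, concave,
positive and homogeneous of degree one on `K`. -/
structure IsCurvatureFunction {n : ℕ} (f : (Fin n → ℝ) → ℝ) (K : Set (Fin n → ℝ)) : Prop where
  isOpen : IsOpen K
  convex : Convex ℝ K
  smul_mem : ∀ κ ∈ K, ∀ c : ℝ, 0 < c → c • κ ∈ K
  perm_mem : ∀ κ ∈ K, ∀ σ : Equiv.Perm (Fin n), κ ∘ σ ∈ K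
  orthant_subset : {κ : Fin n → ℝ | ∀ i, 0 ≤ κ i} ⊆ closure K
  differentiableOn : DifferentiableOn ℝ f K
  perm : ∀ κ ∈ K, ∀ σ : Equiv.Perm (Fin n), f (κ ∘ σ) = f κ
  deriv_pos : ∀ κ ∈ K, ∀ i, 0 < fderiv ℝ f κ (Pi.single i 1)
  concaveOn : ConcaveOn ℝ K f
  pos : ∀ κ ∈ K, 0 < f κ
  homogeneous : ∀ κ ∈ K, ∀ c : ℝ, 0 < c → f (c • κ) = c * f κ

/-- `κ` lists, with multiplicity, the principal curvatures at `x` of the level set of `ρ` through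
`x`, with respect to the unit normal `-∇ρ/|∇ρ|`: in some orthonormal basis `e` of the tangent space
`(∇ρ x)ᗮ`, the second fundamental form `D²ρ/|∇ρ|` is diagonal with entries `κ`.
(Level sets of a function decreasing inwards bounding convex regions have `κ ≥ 0`.) -/
def IsPrincipalCurvatures {n : ℕ} (ρ : EuclideanSpace ℝ (Fin (n + 1)) → ℝ)
    (x : EuclideanSpace ℝ (Fin (n + 1))) (κ : Fin n → ℝ) : Prop :=
  gradient ρ x ≠ 0 ∧
  ∃ e : Fin n → EuclideanSpace ℝ (Fin (n + 1)), Orthonormal ℝ e ∧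
    (∀ i, inner ℝ (e i) (gradient ρ x) = 0) ∧
    ∀ i j, fderiv ℝ (fderiv ℝ ρ) x (e i) (e j) / ‖gradient ρ x‖ = if i = j then κ i else 0

/-- `ρ` is a `C²` local defining function at the boundary point `x` of the set `U`: near `x` the set
`U` is `{ρ < 0}`, and `ρ x = 0`, `∇ρ x ≠ 0`. -/
structure IsLocalDefiningFunction {n : ℕ} (U : Set (EuclideanSpace ℝ (Fin (n + 1))))
    (ρ : EuclideanSpace ℝ (Fin (n + 1)) → ℝ) (x : EuclideanSpace ℝ (Fin (n + 1))) : Prop where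
  contDiffAt : ContDiffAt ℝ 2 ρ x
  eq_zero : ρ x = 0
  gradient_ne_zero : gradient ρ x ≠ 0
  mem_iff : ∀ᶠ y in nhds x, (y ∈ U ↔ ρ y < 0)

/-- `∂U` is a `C²` hypersurface near `x`, with `U` locally on one side of it. -/
def IsC2BoundaryPoint {n : ℕ} (U : Set (EuclideanSpace ℝ (Fin (n + 1))))
    (x : EuclideanSpace ℝ (Fin (n + 1))) : Prop :=
  ∃ ρ, IsLocalDefiningFunction U ρ x

/-- The `δ`-Andrews condition at the boundary point `x` of the open set `U`: near `x` the boundary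
is a `C²` hypersurface, its principal curvatures `κ` at `x` with respect to the inner normal `ν`
lie in `K`, and the ball of radius `r = δ / f κ` centred at `x + r ν` (the ball of that radius
tangent to `∂U` at `x` from inside) lies in `U`. -/
def AndrewsAt {n : ℕ} (f : (Fin n → ℝ) → ℝ) (K : Set (Fin n → ℝ)) (δ : ℝ)
    (U : Set (EuclideanSpace ℝ (Fin (n + 1)))) (x : EuclideanSpace ℝ (Fin (n + 1))) : Prop :=
  ∃ ρ, IsLocalDefiningFunction U ρ x ∧ ∃ κ, IsPrincipalCurvatures ρ x κ ∧ κ ∈ K ∧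
    Metric.ball (x + (δ / f κ) • (-(‖gradient ρ x‖⁻¹ • gradient ρ x))) (δ / f κ) ⊆ U

/-- A classical solution of `|∇u| F(A[Γ_t]) = 1` in `Ω`, `u = 0` on `∂Ω`. The function `u` is
`C^{1,1}` on the closure of `Ω` and smooth at its noncritical points. The second fundamental form of
a level set has no meaning at critical points of `u`; these have no interior, and the equation holds
at all other points of `Ω`. -/
structure IsLevelSetSolution {n : ℕ} (f : (Fin n → ℝ) → ℝ) (K : Set (Fin n → ℝ))
    (Ω : Set (EuclideanSpace ℝ (Fin (n + 1)))) (u : EuclideanSpace ℝ (Fin (n + 1)) → ℝ) :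
    Prop where
  differentiableAt : ∀ x ∈ closure Ω, DifferentiableAt ℝ u x
  lipschitz : ∃ L : NNReal, LipschitzOnWith L (gradient u) (closure Ω)
  smooth : ∀ x ∈ closure Ω, gradient u x ≠ 0 → ContDiffAt ℝ ∞ u x
  dense_noncritical : Ω ⊆ closure {x ∈ Ω | gradient u x ≠ 0}
  equation : ∀ x ∈ Ω, gradient u x ≠ 0 →
    ∃ κ, IsPrincipalCurvatures u x κ ∧ κ ∈ K ∧ ‖gradient u x‖ * f κ = 1
  boundary : ∀ x ∈ frontier Ω, u x = 0

/-!
Write `w = -u` for the arrival time, so that `∇w` points into the superlevel sets of `w`. By the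
equation the ball in the Andrews condition at `x` has radius `δ |∇w x|` and centre `x + δ ∇w x`.
That it lies in `{w > w x}` says that `2 ⟨∇w x, y - x⟩ ≤ |y - x|² / δ` for all `y` which are not in
this set. This is a statement about pairs of points, proved by a maximum principle
(`two_point_estimate`).

By homogeneity of `f` the equation says that `f = 1` on the eigenvalues of `D²u` restricted to the
tangent space of the level set. Since `f` is concave and symmetric, the tangent plane of `f` at the
eigenvalues for `x` bounds the equation at any other point, in any frame of the tangent space there
(`sum_fderiv_mul_sub_nonneg`, which rests on Birkhoff's theorem on doubly stochastic matrices).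
Applied along a line through `x` this yields the differentiated equation, although `f` is only
once differentiable (`differentiated_equation`).

The quotient `2 ⟨∇w x, y - x⟩ / |y - x|²` cannot be maximised directly: it is not continuous at the
diagonal, least of all at critical points of `u`. With the exponent `2 (1 - ε)` in the denominator
it tends to zero at the diagonal, because `∇u` is Lipschitz (`exists_rough_estimate`). Suppose that
this quotient, diminished by `ε w x`, exceeds the bound which the hypothesis gives for `x ∈ ∂Ω`, and
let it be maximal at `(x, y)`. Then `x` is an interior noncritical point. With an inactive
constraint, or a critical point `y`, the maximum in `y` for fixed `x` would have to satisfy a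
relation between `2 ⟨∇w x, y - x⟩` and `|y - x|²` which the exponent excludes. So `y` is
noncritical, `w y = w x`, and there is a Lagrange multiplier (`IsTwoPointMax.exists_multiplier`).
Next the second variations are computed for a principal frame at `x` and its image at `y` under the rotation
taking one normal to the other, or under the reflection exchanging them, and added with the weights
`∂f/∂κ_i`. The first-order conditions and the differentiated equation reduce the result to a single
sum times a coefficient which is nonpositive for the rotation and nonnegative for the reflection
(`sign_of_coefficients`), so one of the two choices is favourable. The term `ε w x` makes the
inequality strict, a contradiction (`not_isTwoPointMax`). Finally `ε → 0`.

Three facts come from the maximum principle for the equation itself, with paraboloids as barriers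
(`not_isLocalMax_sub_paraboloid`; the density of the noncritical points takes care of touching at
critical points). The solution is negative in `Ω` (`neg_of_mem`). A critical point does not lie on a
`C²` part of the boundary of a superlevel set of `w`, by a Hopf lemma
(`gradient_ne_zero_of_isC2BoundaryPoint`). And since `u < 0` inside, the inner normal of `∂Ω` is
`∇w / |∇w|`, which allows the hypothesis on `∂Ω` to be read in terms of `u`
(`ball_subset_of_andrewsAt`).
-/

/-! ### Curvature functions -/

namespace IsCurvatureFunction

variable {n : ℕ} {f : (Fin n → ℝ) → ℝ} {K : Set (Fin n → ℝ)}

lemma nonempty (hf : IsCurvatureFunction f K) : K.Nonempty :=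
  closure_nonempty_iff.1 ⟨0, hf.orthant_subset fun _ ↦ le_rfl⟩

lemma add_mem (hf : IsCurvatureFunction f K) {κ μ : Fin n → ℝ} (hκ : κ ∈ K) (hμ : 0 ≤ μ) :
    κ + μ ∈ K := by
  have h := hf.convex.combo_interior_closure_mem_interior (hf.isOpen.interior_eq.symm ▸ hκ)
    (hf.orthant_subset hμ) (a := (1 / 2 : ℝ)) (b := 1 / 2) (by norm_num) (by norm_num)
    (by norm_num)
  have h2 := hf.smul_mem _ (interior_subset h) 2 two_pos
  convert h2 using 1
  ext i
  simp
  ring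

lemma const_mem (hf : IsCurvatureFunction f K) {σ : ℝ} (hσ : 0 < σ) :
    (fun _ ↦ σ : Fin n → ℝ) ∈ K := by
  obtain ⟨κ, hκ⟩ := hf.nonempty
  -- The vector is interior to the orthant, and an open convex set is the interior of its closure.
  have hint : (fun _ ↦ σ : Fin n → ℝ) ∈ interior (closure K) := by
    refine mem_interior.2 ⟨Set.univ.pi fun _ ↦ Set.Ioi 0, fun μ hμ ↦ ?_, ?_, ?_⟩
    · exact hf.orthant_subset fun i ↦ le_of_lt (hμ i trivial)
    · exact isOpen_set_pi Set.finite_univ fun _ _ ↦ isOpen_Ioi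
    · exact fun i _ ↦ hσ
  rwa [hf.convex.interior_closure_eq_interior_of_nonempty_interior
    (hf.isOpen.interior_eq.symm ▸ ⟨κ, hκ⟩), hf.isOpen.interior_eq] at hint

lemma differentiableAt (hf : IsCurvatureFunction f K) {κ : Fin n → ℝ} (hκ : κ ∈ K) :
    DifferentiableAt ℝ f κ :=
  hf.differentiableOn.differentiableAt (hf.isOpen.mem_nhds hκ)

lemma fderiv_eq_sum (κ v : Fin n → ℝ) :
    fderiv ℝ f κ v = ∑ i, fderiv ℝ f κ (Pi.single i 1) * v i := by
  conv_lhs => rw [pi_eq_sum_univ' v]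
  simp [map_sum, mul_comm]

/-- The graph of the concave function `f` lies below its tangent planes. -/
lemma sub_le_fderiv (hf : IsCurvatureFunction f K) {κ μ : Fin n → ℝ} (hκ : κ ∈ K) (hμ : μ ∈ K) :
    f μ - f κ ≤ ∑ i, fderiv ℝ f κ (Pi.single i 1) * (μ i - κ i) := by
  have hd : HasDerivAt (fun t : ℝ ↦ f (κ + t • (μ - κ))) (fderiv ℝ f κ (μ - κ)) 0 := by
    have h1 : HasDerivAt (fun t : ℝ ↦ κ + t • (μ - κ)) (μ - κ) 0 := by
      simpa using ((hasDerivAt_id (0 : ℝ)).smul_const (μ - κ)).const_add κ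
    have h2 : HasFDerivAt f (fderiv ℝ f κ) (κ + (0 : ℝ) • (μ - κ)) := by
      simpa using (hf.differentiableAt hκ).hasFDerivAt
    exact h2.comp_hasDerivAt 0 h1
  have hs := hd.tendsto_slope_zero_right
  have : ∀ᶠ t : ℝ in nhdsWithin 0 (Set.Ioi 0),
      f μ - f κ ≤ t⁻¹ • (f (κ + (0 + t) • (μ - κ)) - f (κ + (0 : ℝ) • (μ - κ))) := by
    filter_upwards [Ioo_mem_nhdsGT (zero_lt_one' ℝ)] with t ht
    have hc := hf.concaveOn.2 hκ hμ (show 0 ≤ 1 - t by linarith [ht.2]) ht.1.le (by ring)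
    have he : (1 - t) • κ + t • μ = κ + t • (μ - κ) := by
      rw [sub_smul, smul_sub, one_smul]; abel
    rw [he, smul_eq_mul, smul_eq_mul] at hc
    rw [zero_add, zero_smul, add_zero, smul_eq_mul, le_inv_mul_iff₀ ht.1]
    linarith
  have := ge_of_tendsto hs this
  rwa [fderiv_eq_sum] at this

lemma sum_fderiv_mul_pos (hf : IsCurvatureFunction f K) {κ : Fin n → ℝ} (hκ : κ ∈ K) :
    0 < ∑ i, fderiv ℝ f κ (Pi.single i 1) * κ i := by
  have h := hf.sub_le_fderiv hκ (hf.smul_mem κ hκ 2 two_pos)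
  rw [hf.homogeneous κ hκ 2 two_pos] at h
  have h3 : ∀ i, ((2 : ℝ) • κ) i - κ i = κ i := fun i ↦ by simp; ring
  simp_rw [h3] at h
  linarith [hf.pos κ hκ]

lemma mono (hf : IsCurvatureFunction f K) {κ μ : Fin n → ℝ} (hκ : κ ∈ K) (h : κ ≤ μ) :
    μ ∈ K ∧ f κ ≤ f μ := by
  have hμ : μ ∈ K := by simpa using hf.add_mem hκ (sub_nonneg.2 h)
  refine ⟨hμ, ?_⟩
  have h1 := hf.sub_le_fderiv hμ hκ
  have h2 : ∑ i, fderiv ℝ f μ (Pi.single i 1) * (κ i - μ i) ≤ 0 :=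
    Finset.sum_nonpos fun i _ ↦
      mul_nonpos_of_nonneg_of_nonpos (hf.deriv_pos μ hμ i).le (sub_nonpos.2 (h i))
  linarith

lemma apply_const (hf : IsCurvatureFunction f K) {σ : ℝ} (hσ : 0 < σ) :
    f (fun _ ↦ σ) = σ * f (fun _ ↦ 1) := by
  rw [← hf.homogeneous _ (hf.const_mem one_pos) σ hσ]
  congr 1
  ext
  simp

end IsCurvatureFunction

/-- A doubly stochastic matrix moves the argument of a symmetric concave function to an average of
its permutations, hence does not decrease the function. -/
lemma IsCurvatureFunction.mulVec_doublyStochastic {n : ℕ} {f : (Fin n → ℝ) → ℝ}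
    {K : Set (Fin n → ℝ)} (hf : IsCurvatureFunction f K) {κ : Fin n → ℝ} (hκ : κ ∈ K)
    {P : Matrix (Fin n) (Fin n) ℝ} (hP : P ∈ doublyStochastic ℝ (Fin n)) :
    P.mulVec κ ∈ K ∧ f κ ≤ f (P.mulVec κ) := by
  obtain ⟨w, hw0, hw1, rfl⟩ := exists_eq_sum_perm_of_mem_doublyStochastic hP
  have he : (∑ σ, w σ • Equiv.Perm.permMatrix ℝ σ).mulVec κ = ∑ σ, w σ • (κ ∘ σ) := by
    rw [Matrix.sum_mulVec]
    refine Finset.sum_congr rfl fun σ _ ↦ ?_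
    rw [Matrix.smul_mulVec, Matrix.permMatrix_mulVec]
  rw [he]
  refine ⟨hf.convex.sum_mem (fun σ _ ↦ hw0 σ) hw1 fun σ _ ↦ hf.perm_mem κ hκ σ, ?_⟩
  have := hf.concaveOn.le_map_sum (fun σ (_ : σ ∈ Finset.univ) ↦ hw0 σ) hw1
    (fun σ _ ↦ hf.perm_mem κ hκ σ)
  refine le_trans (le_of_eq ?_) this
  simp_rw [hf.perm κ hκ, smul_eq_mul, ← Finset.sum_mul, hw1, one_mul]

/-! ### Orthonormal frames of a hyperplane -/

/-- The Euclidean space of dimension `n + 1` containing the hypersurfaces. -/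
abbrev Ambient (n : ℕ) : Type := EuclideanSpace ℝ (Fin (n + 1))

section Frames

variable {n : ℕ}

/-- An orthonormal frame of a hyperplane together with the unit normal spans the space. -/
lemma eq_add_sum_frame {e : Fin n → Ambient n} (he : Orthonormal ℝ e) {ν : Ambient n} (hν : ‖ν‖ = 1)
    (heν : ∀ i, inner ℝ (e i) ν = 0) (v : Ambient n) :
    v = inner ℝ ν v • ν + ∑ i, inner ℝ (e i) v • e i := by
  have hon : Orthonormal ℝ (Fin.cons ν e : Fin (n + 1) → Ambient n) := by
    rw [orthonormal_iff_ite] at he ⊢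
    intro i j
    refine Fin.cases ?_ (fun i ↦ ?_) i <;> refine Fin.cases ?_ (fun j ↦ ?_) j
    · simp [hν]
    · simpa [real_inner_comm, (Fin.succ_ne_zero j).symm] using heν j
    · simpa using heν i
    · simpa using he i j
  let b := basisOfOrthonormalOfCardEqFinrank hon (by simp)
  have hb : ⇑b = Fin.cons ν e := coe_basisOfOrthonormalOfCardEqFinrank hon (by simp)
  let o := b.toOrthonormalBasis (by rw [hb]; exact hon)
  have h := o.sum_repr v
  rw [Fin.sum_univ_succ] at h
  have ho : ⇑o = Fin.cons ν e := by rw [← hb]; exact b.coe_toOrthonormalBasis _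
  simpa [o.repr_apply_apply, ho] using h.symm

lemma norm_sq_eq_sum_frame {e : Fin n → Ambient n} (he : Orthonormal ℝ e) {ν : Ambient n}
    (hν : ‖ν‖ = 1) (heν : ∀ i, inner ℝ (e i) ν = 0) (v : Ambient n) :
    inner ℝ v v = inner ℝ ν v ^ 2 + ∑ i, inner ℝ (e i) v ^ 2 := by
  conv_lhs => enter [2]; rw [eq_add_sum_frame he hν heν v]
  rw [inner_add_left, inner_smul_left, sum_inner]
  simp [inner_smul_left, pow_two]

/-- Let a form be diagonal in an orthonormal frame of `gᗮ`, with admissible entries. Then its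
diagonal in any other orthonormal frame of `gᗮ` is admissible, and `f` of it is not smaller. -/
lemma IsCurvatureFunction.diag_of_frame {f : (Fin n → ℝ) → ℝ} {K : Set (Fin n → ℝ)}
    (hf : IsCurvatureFunction f K) {κ : Fin n → ℝ} (hκ : κ ∈ K)
    (B : Ambient n →L[ℝ] Ambient n →L[ℝ] ℝ) {g : Ambient n}
    (hg : g ≠ 0) {e e' : Fin n → Ambient n} (he : Orthonormal ℝ e) (heg : ∀ i, inner ℝ (e i) g = 0)
    (hB : ∀ i j, B (e i) (e j) = if i = j then κ i else 0)
    (he' : Orthonormal ℝ e') (heg' : ∀ i, inner ℝ (e' i) g = 0) :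
    (fun i ↦ B (e' i) (e' i)) ∈ K ∧ f κ ≤ f (fun i ↦ B (e' i) (e' i)) := by
  have hν : ‖‖g‖⁻¹ • g‖ = 1 := norm_smul_inv_norm (𝕜 := ℝ) hg
  have h1 : ∀ i, inner ℝ (e i) (‖g‖⁻¹ • g) = 0 := fun i ↦ by simp [inner_smul_right, heg]
  have h2 : ∀ i, inner ℝ (e' i) (‖g‖⁻¹ • g) = 0 := fun i ↦ by simp [inner_smul_right, heg']
  let P : Matrix (Fin n) (Fin n) ℝ := fun i j ↦ inner ℝ (e j) (e' i) ^ 2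
  have hP : P ∈ doublyStochastic ℝ (Fin n) := by
    rw [mem_doublyStochastic_iff_sum]
    refine ⟨fun i j ↦ sq_nonneg _, fun i ↦ ?_, fun j ↦ ?_⟩
    · have := norm_sq_eq_sum_frame he hν h1 (e' i)
      rw [real_inner_comm (e' i) (‖g‖⁻¹ • g), h2, real_inner_self_eq_norm_sq, he'.1 i] at this
      simpa using this.symm
    · have := norm_sq_eq_sum_frame he' hν h2 (e j)
      rw [real_inner_comm (e j) (‖g‖⁻¹ • g), h1, real_inner_self_eq_norm_sq, he.1 j] at this
      simpa [P, real_inner_comm] using this.symm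
  have hd : (fun i ↦ B (e' i) (e' i)) = P.mulVec κ := by
    ext i
    have hx : e' i = ∑ j, inner ℝ (e j) (e' i) • e j := by
      have := eq_add_sum_frame he hν h1 (e' i)
      rwa [real_inner_comm, h2, zero_smul, zero_add] at this
    conv_lhs => rw [hx]
    simp [Matrix.mulVec, dotProduct, hB, P, pow_two, mul_comm, mul_left_comm]
  rw [hd]
  exact hf.mulVec_doublyStochastic hκ hP

end Frames

/-! ### Derivatives along curves -/

section Calculus

open Filter Topology

lemma HasDerivAt.nonpos_of_eventually_le {h : ℝ → ℝ} {h' : ℝ} (hd : HasDerivAt h h' 0)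
    (hle : ∀ᶠ t in 𝓝[>] (0 : ℝ), h t ≤ h 0) : h' ≤ 0 := by
  refine le_of_tendsto hd.tendsto_slope_zero_right ?_
  filter_upwards [hle, self_mem_nhdsWithin] with t ht ht0
  rw [zero_add, smul_eq_mul]
  exact mul_nonpos_of_nonneg_of_nonpos (inv_nonneg.2 (le_of_lt ht0)) (sub_nonpos.2 ht)

lemma HasDerivAt.eventually_lt_of_pos {h : ℝ → ℝ} {h' : ℝ} (hd : HasDerivAt h h' 0)
    (hpos : 0 < h') : ∀ᶠ t in 𝓝[>] (0 : ℝ), h 0 < h t := by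
  filter_upwards [hd.tendsto_slope_zero_right.eventually (lt_mem_nhds hpos),
    self_mem_nhdsWithin] with t ht ht0
  rw [zero_add, smul_eq_mul] at ht
  exact sub_pos.1 (pos_of_mul_pos_right ht (inv_nonneg.2 (le_of_lt ht0)))

lemma isLocalMin_of_second_deriv_pos {h h₁ : ℝ → ℝ} {h₂ : ℝ}
    (hd : ∀ᶠ t in 𝓝 (0 : ℝ), HasDerivAt h (h₁ t) t) (hd₂ : HasDerivAt h₁ h₂ 0)
    (h0 : h₁ 0 = 0) (hpos : 0 < h₂) : IsLocalMin h 0 := by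
  have he : deriv h =ᶠ[𝓝 0] h₁ := hd.mono fun t ht ↦ ht.deriv
  refine isLocalMin_of_deriv_deriv_pos ?_ ?_ hd.self_of_nhds.continuousAt
  · rwa [he.deriv_eq, hd₂.deriv]
  · rw [he.eq_of_nhds, h0]

lemma second_deriv_nonneg_of_isLocalMin {h h₁ : ℝ → ℝ} {h₂ : ℝ}
    (hd : ∀ᶠ t in 𝓝 (0 : ℝ), HasDerivAt h (h₁ t) t) (hd₂ : HasDerivAt h₁ h₂ 0)
    (hm : IsLocalMin h 0) : 0 ≤ h₂ := by
  by_contra! hneg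
  have h0 : h₁ 0 = 0 := hm.hasDerivAt_eq_zero hd.self_of_nhds
  have hmin : IsLocalMin (fun t ↦ -h t) 0 :=
    isLocalMin_of_second_deriv_pos (h₁ := fun t ↦ -h₁ t) (h₂ := -h₂)
      (hd.mono fun t ht ↦ ht.neg) hd₂.neg (by simp [h0]) (by linarith)
  -- `h` has both a local minimum and a local maximum, so it is locally constant.
  have hc : h =ᶠ[𝓝 0] fun _ ↦ h 0 := by
    filter_upwards [hm, hmin] with t h1 h2
    linarith
  have h1 : h₁ =ᶠ[𝓝 0] fun _ ↦ 0 := by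
    filter_upwards [hd, hc.eventuallyEq_nhds] with t ht1 ht2
    exact ht1.unique ((hasDerivAt_const t (h 0)).congr_of_eventuallyEq ht2)
  have := hd₂.unique ((hasDerivAt_const (0 : ℝ) (0 : ℝ)).congr_of_eventuallyEq h1)
  linarith

lemma second_deriv_nonpos_of_isLocalMax {h h₁ : ℝ → ℝ} {h₂ : ℝ}
    (hd : ∀ᶠ t in 𝓝 (0 : ℝ), HasDerivAt h (h₁ t) t) (hd₂ : HasDerivAt h₁ h₂ 0)
    (hm : IsLocalMax h 0) : h₂ ≤ 0 := by
  have := second_deriv_nonneg_of_isLocalMin (h := fun t ↦ -h t) (h₁ := fun t ↦ -h₁ t)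
    (hd.mono fun t ht ↦ ht.neg) hd₂.neg hm.neg
  linarith

variable {V : Type*} [NormedAddCommGroup V] [NormedSpace ℝ V]

lemma hasDerivAt_quadratic_curve (x ξ η : V) (t : ℝ) :
    HasDerivAt (fun t : ℝ ↦ x + t • ξ + t ^ 2 • η) (ξ + (2 * t) • η) t := by
  have h1 := ((hasDerivAt_id t).smul_const ξ).const_add x
  have h2 := (hasDerivAt_pow 2 t).smul_const η
  exact (h1.add h2).congr_deriv (by simp)

lemma tendsto_quadratic_curve (x ξ η : V) :
    Tendsto (fun t : ℝ ↦ x + t • ξ + t ^ 2 • η) (𝓝 0) (𝓝 x) := by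
  have := (hasDerivAt_quadratic_curve x ξ η 0).continuousAt.tendsto
  simpa using this

lemma ContDiffAt.hasDerivAt_quadratic_curve {φ : V → ℝ} {x : V} (hφ : ContDiffAt ℝ 2 φ x)
    (ξ η : V) :
    (∀ᶠ t in 𝓝 (0 : ℝ), HasDerivAt (fun t : ℝ ↦ φ (x + t • ξ + t ^ 2 • η))
      (fderiv ℝ φ (x + t • ξ + t ^ 2 • η) (ξ + (2 * t) • η)) t) ∧
    HasDerivAt (fun t : ℝ ↦ fderiv ℝ φ (x + t • ξ + t ^ 2 • η) (ξ + (2 * t) • η))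
      (fderiv ℝ (fderiv ℝ φ) x ξ ξ + 2 * fderiv ℝ φ x η) 0 := by
  constructor
  · have h1 : ∀ᶠ y in 𝓝 x, DifferentiableAt ℝ φ y :=
      (hφ.eventually (by simp)).mono fun y hy ↦ hy.differentiableAt (by simp)
    filter_upwards [(tendsto_quadratic_curve x ξ η).eventually h1] with t ht
    exact ht.hasFDerivAt.comp_hasDerivAt t (_root_.hasDerivAt_quadratic_curve x ξ η t)
  · have hD : HasFDerivAt (fderiv ℝ φ) (fderiv ℝ (fderiv ℝ φ) x)
        (x + (0 : ℝ) • ξ + (0 : ℝ) ^ 2 • η) := by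
      have : ContDiffAt ℝ 1 (fderiv ℝ φ) x := hφ.fderiv_right (by norm_num)
      simpa using (this.differentiableAt (by simp)).hasFDerivAt
    have h1 := hD.comp_hasDerivAt 0 (_root_.hasDerivAt_quadratic_curve x ξ η 0)
    have h2 : HasDerivAt (fun t : ℝ ↦ ξ + (2 * t) • η) ((2 : ℝ) • η) 0 := by
      simpa using (((hasDerivAt_id (0 : ℝ)).const_mul 2).smul_const η).const_add ξ
    have h3 := h1.clm_apply h2
    simpa using h3

/-- Two linear functionals with `ℓ ≤ 0` on the open half-space `q > 0` are proportional: the case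
of the Farkas lemma that yields the Lagrange multiplier of one inequality constraint. -/
lemma exists_multiplier {W : Type*} [AddCommGroup W] [Module ℝ W] (ℓ q : W →ₗ[ℝ] ℝ) (hq : q ≠ 0)
    (h : ∀ v, 0 < q v → ℓ v ≤ 0) : ∃ c : ℝ, 0 ≤ c ∧ ∀ v, ℓ v = -c * q v := by
  obtain ⟨w, hw⟩ : ∃ w, q w ≠ 0 := by
    by_contra! hc
    exact hq (LinearMap.ext hc)
  obtain ⟨v₀, hq₀⟩ : ∃ v₀, q v₀ = 1 := ⟨(q w)⁻¹ • w, by simp [hw]⟩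
  have hker : ∀ v, q v = 0 → ℓ v = 0 := by
    intro v hv
    by_contra hne
    have := h (v₀ + ((1 - ℓ v₀) / ℓ v) • v) (by simp [hq₀, hv])
    rw [map_add, map_smul, smul_eq_mul, div_mul_cancel₀ _ hne] at this
    linarith
  refine ⟨-ℓ v₀, by linarith [h v₀ (by simp [hq₀])], fun v ↦ ?_⟩
  have := hker (v - q v • v₀) (by simp [hq₀])
  rw [map_sub, map_smul, smul_eq_mul] at this
  linarith

lemma ContDiffAt.fderiv_fderiv_comm {φ : V → ℝ} {x : V} (hφ : ContDiffAt ℝ 2 φ x) (a b : V) :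
    fderiv ℝ (fderiv ℝ φ) x a b = fderiv ℝ (fderiv ℝ φ) x b a :=
  (hφ.isSymmSndFDerivAt (by simp)) a b

/-- The third derivative is symmetric. -/
lemma ContDiffAt.fderiv_fderiv_fderiv_rotate {φ : V → ℝ} {x : V} (hφ : ContDiffAt ℝ 3 φ x)
    (a b c : V) :
    fderiv ℝ (fderiv ℝ (fderiv ℝ φ)) x a b c = fderiv ℝ (fderiv ℝ (fderiv ℝ φ)) x c a b := by
  have h2 : ContDiffAt ℝ 2 (fderiv ℝ φ) x := hφ.fderiv_right (by norm_num)
  have h1 : ContDiffAt ℝ 1 (fderiv ℝ (fderiv ℝ φ)) x := h2.fderiv_right (by norm_num)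
  have hs : ∀ a b, fderiv ℝ (fderiv ℝ (fderiv ℝ φ)) x a b =
      fderiv ℝ (fderiv ℝ (fderiv ℝ φ)) x b a := fun a b ↦ (h2.isSymmSndFDerivAt (by simp)) a b
  have happ : ∀ b c, HasFDerivAt (fun y ↦ fderiv ℝ (fderiv ℝ φ) y b c)
      (((ContinuousLinearMap.apply ℝ ℝ c).comp (ContinuousLinearMap.apply ℝ (V →L[ℝ] ℝ) b)).comp
        (fderiv ℝ (fderiv ℝ (fderiv ℝ φ)) x)) x := by
    intro b c
    exact ((ContinuousLinearMap.apply ℝ ℝ c).comp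
      (ContinuousLinearMap.apply ℝ (V →L[ℝ] ℝ) b)).hasFDerivAt.comp (f := fderiv ℝ (fderiv ℝ φ)) x
        (h1.differentiableAt (by simp)).hasFDerivAt
  have he : (fun y ↦ fderiv ℝ (fderiv ℝ φ) y b c) =ᶠ[𝓝 x]
      fun y ↦ fderiv ℝ (fderiv ℝ φ) y c b := by
    filter_upwards [hφ.eventually (by simp)] with y hy
    exact (hy.of_le (by norm_num)).fderiv_fderiv_comm b c
  have hu := ((happ b c).congr_of_eventuallyEq he.symm).unique (happ c b)
  have := congrArg (fun T : V →L[ℝ] ℝ ↦ T a) hu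
  simp only [ContinuousLinearMap.comp_apply, ContinuousLinearMap.apply_apply] at this
  rw [this, hs a c]

end Calculus

/-! ### Paraboloids as barriers -/

section Barrier

open Filter Topology

variable {n : ℕ}

lemma fderiv_ne_zero_iff_gradient_ne_zero {u : Ambient n → ℝ} {x : Ambient n} :
    fderiv ℝ u x ≠ 0 ↔ gradient u x ≠ 0 := by
  simp [gradient]

lemma eq_fderiv_of_isLocalMax_sub_paraboloid {u : Ambient n → ℝ} {x c : Ambient n} {σ : ℝ}
    (hu : DifferentiableAt ℝ u x) (hm : IsLocalMax (fun y ↦ u y - σ * ‖y - c‖ ^ 2) x)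
    (v : Ambient n) :
    fderiv ℝ u x v = 2 * σ * inner ℝ (x - c) v := by
  have h1 : HasFDerivAt (fun y ↦ ‖y - c‖ ^ 2) (2 • (innerSL ℝ (x - c)).comp
      (ContinuousLinearMap.id ℝ (Ambient n))) x := ((hasFDerivAt_id x).sub_const c).norm_sq
  have h2 := hm.hasFDerivAt_eq_zero (hu.hasFDerivAt.sub (h1.const_mul σ))
  have h3 := congrArg (fun T : Ambient n →L[ℝ] ℝ ↦ T v) h2
  simp at h3
  rw [inner_sub_left]
  linarith

lemma fderiv_fderiv_le_of_isLocalMax_sub_paraboloid {u : Ambient n → ℝ} {x c : Ambient n} {σ : ℝ}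
    (hu : ContDiffAt ℝ 2 u x) (hm : IsLocalMax (fun y ↦ u y - σ * ‖y - c‖ ^ 2) x) (v : Ambient n) :
    fderiv ℝ (fderiv ℝ u) x v v ≤ 2 * σ * ‖v‖ ^ 2 := by
  obtain ⟨h1, h2⟩ := hu.hasDerivAt_quadratic_curve v 0
  have hs : ∀ t : ℝ, ‖x + t • v + t ^ 2 • (0 : Ambient n) - c‖ ^ 2
      = ‖x - c‖ ^ 2 + 2 * t * inner ℝ (x - c) v + t ^ 2 * ‖v‖ ^ 2 := by
    intro t
    have : x + t • v + t ^ 2 • (0 : Ambient n) - c = (x - c) + t • v := by rw [smul_zero]; abel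
    rw [this, norm_add_sq_real, inner_smul_right, norm_smul, mul_pow, Real.norm_eq_abs, sq_abs]
    ring
  have d1 : ∀ t : ℝ, HasDerivAt (fun t : ℝ ↦ σ * ‖x + t • v + t ^ 2 • (0 : Ambient n) - c‖ ^ 2)
      (σ * (2 * inner ℝ (x - c) v + 2 * t * ‖v‖ ^ 2)) t := by
    intro t
    simp_rw [hs]
    have := (((((hasDerivAt_id t).const_mul 2).mul_const (inner ℝ (x - c) v)).const_add
      (‖x - c‖ ^ 2)).add ((hasDerivAt_pow 2 t).mul_const (‖v‖ ^ 2))).const_mul σ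
    exact this.congr_deriv (by simp)
  have d2 : HasDerivAt (fun t : ℝ ↦ σ * (2 * inner ℝ (x - c) v + 2 * t * ‖v‖ ^ 2))
      (2 * σ * ‖v‖ ^ 2) 0 := by
    have := ((((hasDerivAt_id (0 : ℝ)).const_mul 2).mul_const (‖v‖ ^ 2)).const_add
      (2 * inner ℝ (x - c) v)).const_mul σ
    exact this.congr_deriv (by ring)
  have hm' : IsLocalMax (fun t : ℝ ↦ u (x + t • v + t ^ 2 • (0 : Ambient n)) -
      σ * ‖x + t • v + t ^ 2 • (0 : Ambient n) - c‖ ^ 2) 0 := by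
    have := (tendsto_quadratic_curve x v 0).eventually hm
    filter_upwards [this] with t ht
    simpa using ht
  have := second_deriv_nonpos_of_isLocalMax
    (h1.mono fun t ht ↦ ht.sub (d1 t)) (h2.sub d2) hm'
  simp at this
  linarith

namespace IsLevelSetSolution

variable {f : (Fin n → ℝ) → ℝ} {K : Set (Fin n → ℝ)} {Ω : Set (Ambient n)} {u : Ambient n → ℝ}

lemma contDiffAt (hu : IsLevelSetSolution f K Ω u) {x : Ambient n} (hx : x ∈ closure Ω)
    (hg : gradient u x ≠ 0) (k : ℕ) : ContDiffAt ℝ k u x :=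
  (hu.smooth x hx hg).of_le (WithTop.coe_le_coe.2 le_top)

/-- By homogeneity the equation says that `f = 1` on the eigenvalues of `D²u` restricted to the
tangent space of the level set. -/
lemma exists_frame (hf : IsCurvatureFunction f K) (hu : IsLevelSetSolution f K Ω u) {x : Ambient n}
    (hx : x ∈ Ω) (hg : gradient u x ≠ 0) :
    ∃ (A : Fin n → ℝ) (e : Fin n → Ambient n), A ∈ K ∧ f A = 1 ∧ Orthonormal ℝ e ∧
      (∀ i, inner ℝ (e i) (gradient u x) = 0) ∧
      ∀ i j, fderiv ℝ (fderiv ℝ u) x (e i) (e j) = if i = j then A i else 0 := by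
  obtain ⟨κ, ⟨-, e, he, heg, heB⟩, hκ, h1⟩ := hu.equation x hx hg
  have hpos : 0 < ‖gradient u x‖ := norm_pos_iff.2 hg
  refine ⟨‖gradient u x‖ • κ, e, hf.smul_mem κ hκ _ hpos, ?_, he, heg, fun i j ↦ ?_⟩
  · rw [hf.homogeneous κ hκ _ hpos, h1]
  · have := heB i j
    rw [div_eq_iff hpos.ne'] at this
    rw [this]
    split_ifs <;> simp [mul_comm]

/-- The maximum principle: a paraboloid of small opening does not touch `u` from above. At a
noncritical touching point this contradicts the equation. If the touching point is critical, it is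
the vertex; for a slightly wider paraboloid with a noncritical vertex nearby, the touching point is
not the vertex, so it is noncritical. -/
lemma not_isLocalMax_sub_paraboloid (hf : IsCurvatureFunction f K)
    (hu : IsLevelSetSolution f K Ω u) (hΩ : IsOpen Ω) {x c : Ambient n} (hx : x ∈ Ω) {σ : ℝ}
    (hσ : 0 < σ) (hσ1 : 2 * σ * f (fun _ ↦ 1) < 1) :
    ¬ IsLocalMax (fun y ↦ u y - σ * ‖y - c‖ ^ 2) x := by
  have key : ∀ {σ : ℝ} {x c : Ambient n}, 0 < σ → 2 * σ * f (fun _ ↦ 1) < 1 → x ∈ Ω →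
      gradient u x ≠ 0 → ¬ IsLocalMax (fun y ↦ u y - σ * ‖y - c‖ ^ 2) x := by
    intro σ x c hσ hσ1 hx hg hm
    obtain ⟨A, e, hA, hA1, he, -, heA⟩ := hu.exists_frame hf hx hg
    have hle : A ≤ fun _ ↦ 2 * σ := fun i ↦ by
      have := fderiv_fderiv_le_of_isLocalMax_sub_paraboloid
        (hu.contDiffAt (subset_closure hx) hg 2) hm (e i)
      simpa [heA, he.1 i] using this
    have := (hf.mono hA hle).2
    rw [hf.apply_const (by positivity), hA1] at this
    linarith
  intro hm
  by_cases hg : gradient u x ≠ 0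
  · exact key hσ hσ1 hx hg hm
  push Not at hg
  have hcrit : ∀ {σ : ℝ} {x c : Ambient n}, 0 < σ → x ∈ Ω → gradient u x = 0 →
      IsLocalMax (fun y ↦ u y - σ * ‖y - c‖ ^ 2) x → x = c := by
    intro σ x c hσ hx hg hm
    have := eq_fderiv_of_isLocalMax_sub_paraboloid
      (hu.differentiableAt x (subset_closure hx)) hm (x - c)
    rw [← inner_gradient_left, hg, inner_zero_left] at this
    rcases mul_eq_zero.1 this.symm with h | h
    · linarith
    · exact sub_eq_zero.1 (inner_self_eq_zero.1 h)
  obtain rfl : x = c := hcrit hσ hx hg hm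
  obtain ⟨σ', hσσ', hσ'1⟩ : ∃ σ', σ < σ' ∧ 2 * σ' * f (fun _ ↦ 1) < 1 := by
    have hcont : Continuous fun s : ℝ ↦ 2 * s * f (fun _ ↦ 1) := by fun_prop
    have h1 : ∀ᶠ s in 𝓝 σ, 2 * s * f (fun _ ↦ 1) < 1 :=
      hcont.continuousAt.eventually (gt_mem_nhds hσ1)
    obtain ⟨s, hs1, hs2⟩ := ((h1.filter_mono nhdsWithin_le_nhds).and
      (self_mem_nhdsWithin : ∀ᶠ s in 𝓝[>] σ, s ∈ Set.Ioi σ)).exists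
    exact ⟨s, hs2, hs1⟩
  have hσ' : 0 < σ' := hσ.trans hσσ'
  obtain ⟨r, hr, hball⟩ : ∃ r > 0, Metric.closedBall x r ⊆
      Ω ∩ {y | u y - σ * ‖y - x‖ ^ 2 ≤ u x - σ * ‖x - x‖ ^ 2} :=
    Metric.nhds_basis_closedBall.mem_iff.1 (inter_mem (hΩ.mem_nhds hx) hm)
  -- A noncritical vertex `c`, close enough to keep the maximum off the sphere of radius `r`.
  obtain ⟨c, ⟨-, hcg⟩, hcd⟩ : ∃ c ∈ {x ∈ Ω | gradient u x ≠ 0},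
      σ * r ^ 2 + σ' * ‖x - c‖ ^ 2 < σ' * (r - ‖x - c‖) ^ 2 ∧ ‖x - c‖ < r := by
    have hcont : Continuous fun c : Ambient n ↦
        σ' * (r - ‖x - c‖) ^ 2 - (σ * r ^ 2 + σ' * ‖x - c‖ ^ 2) := by fun_prop
    have hcont2 : Continuous fun c : Ambient n ↦ ‖x - c‖ := by fun_prop
    have h1 : ∀ᶠ c in 𝓝 x, 0 < σ' * (r - ‖x - c‖) ^ 2 - (σ * r ^ 2 + σ' * ‖x - c‖ ^ 2) := by
      refine hcont.continuousAt.eventually (lt_mem_nhds ?_)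
      simp
      nlinarith [pow_pos hr 2]
    have h2 : ∀ᶠ c in 𝓝 x, ‖x - c‖ < r :=
      hcont2.continuousAt.eventually (gt_mem_nhds (by simpa using hr))
    obtain ⟨c, hc1, hc2⟩ :=
      ((mem_closure_iff_frequently.1 (hu.dense_noncritical hx)).and_eventually (h1.and h2)).exists
    exact ⟨c, hc1, by linarith [hc2.1], hc2.2⟩
  obtain ⟨y, hyB, hy⟩ := (isCompact_closedBall x r).exists_isMaxOn
    ⟨x, Metric.mem_closedBall_self hr.le⟩
    (f := fun y ↦ u y - σ' * ‖y - c‖ ^ 2) (fun y hy ↦ by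
      have := (hu.differentiableAt y (subset_closure (hball hy).1)).continuousAt
      exact ContinuousAt.continuousWithinAt (by fun_prop))
  have hyr : ‖y - x‖ < r := by
    refine lt_of_le_of_ne (by simpa [dist_eq_norm] using hyB) fun hyr ↦ ?_
    have h1 : u x - σ' * ‖x - c‖ ^ 2 ≤ u y - σ' * ‖y - c‖ ^ 2 :=
      hy (Metric.mem_closedBall_self hr.le)
    have h2 : u y - σ * ‖y - x‖ ^ 2 ≤ u x - σ * ‖x - x‖ ^ 2 := (hball hyB).2
    rw [hyr] at h2
    have h3 : r - ‖x - c‖ ≤ ‖y - c‖ := by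
      rw [← hyr]
      have := norm_sub_le (y - c) (x - c)
      rw [sub_sub_sub_cancel_right] at this
      linarith
    have h4 : (r - ‖x - c‖) ^ 2 ≤ ‖y - c‖ ^ 2 := pow_le_pow_left₀ (by linarith [hcd.2]) h3 2
    simp at h2
    nlinarith [hcd.1]
  have hym : IsLocalMax (fun y ↦ u y - σ' * ‖y - c‖ ^ 2) y :=
    hy.isLocalMax (Metric.closedBall_mem_nhds_of_mem (by simpa [dist_eq_norm] using hyr))
  by_cases hyg : gradient u y = 0
  · exact hcg (hcrit hσ' (hball hyB).1 hyg hym ▸ hyg)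
  · exact key hσ' hσ'1 (hball hyB).1 hyg hym

lemma exists_barrier_coeff (f : (Fin n → ℝ) → ℝ) :
    ∃ σ : ℝ, 0 < σ ∧ 2 * σ * f (fun _ ↦ 1) < 1 := by
  refine ⟨1 / (2 * (|f fun _ ↦ 1| + 1)), by positivity, ?_⟩
  rw [show 2 * (1 / (2 * (|f fun _ ↦ 1| + 1))) * f (fun _ ↦ 1)
    = f (fun _ ↦ 1) / (|f fun _ ↦ 1| + 1) by field_simp, div_lt_one (by positivity)]
  linarith [le_abs_self (f fun _ ↦ 1)]

lemma continuousOn (hu : IsLevelSetSolution f K Ω u) : ContinuousOn u (closure Ω) :=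
  fun x hx ↦ (hu.differentiableAt x hx).continuousAt.continuousWithinAt

lemma neg_of_mem (hf : IsCurvatureFunction f K) (hu : IsLevelSetSolution f K Ω u)
    (hΩ : IsOpen Ω) (hΩb : Bornology.IsBounded Ω) {x : Ambient n} (hx : x ∈ Ω) : u x < 0 := by
  obtain ⟨σ, hσ, hσ1⟩ := exists_barrier_coeff f
  have hmax : ∀ y ∈ Ω, ¬ IsLocalMax u y := fun y hy hm ↦
    hu.not_isLocalMax_sub_paraboloid hf hΩ hy hσ hσ1 (c := y) <| by
      filter_upwards [hm] with w hw
      simp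
      nlinarith [sq_nonneg ‖w - y‖]
  obtain ⟨y, hy, hym⟩ := hΩb.isCompact_closure.exists_isMaxOn ⟨x, subset_closure hx⟩
    hu.continuousOn
  by_contra! hx0
  have hyΩ : y ∉ Ω := fun h ↦ hmax y h (hym.isLocalMax (mem_of_superset (hΩ.mem_nhds h)
    subset_closure))
  have hy0 : u y = 0 := hu.boundary y (by rw [hΩ.frontier_eq]; exact ⟨hy, hyΩ⟩)
  refine hmax x hx ?_
  filter_upwards [hΩ.mem_nhds hx] with w hw
  have h1 : u w ≤ u y := hym (subset_closure hw)
  linarith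

lemma nonpos_of_mem_closure (hf : IsCurvatureFunction f K) (hu : IsLevelSetSolution f K Ω u)
    (hΩ : IsOpen Ω) (hΩb : Bornology.IsBounded Ω) {x : Ambient n} (hx : x ∈ closure Ω) :
    u x ≤ 0 := by
  by_cases h : x ∈ Ω
  · exact (hu.neg_of_mem hf hΩ hΩb h).le
  · exact (hu.boundary x (by rw [hΩ.frontier_eq]; exact ⟨hx, h⟩)).le

end IsLevelSetSolution

/-- The interior ball condition at a `C²` boundary point. -/
lemma IsLocalDefiningFunction.exists_closedBall {U : Set (Ambient n)} {ρ : Ambient n → ℝ}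
    {x : Ambient n} (h : IsLocalDefiningFunction U ρ x) {W : Set (Ambient n)} (hW : W ∈ 𝓝 x) :
    ∃ (c : Ambient n) (R : ℝ), 0 < R ∧ ‖x - c‖ = R ∧ Metric.closedBall c R ⊆ W ∧
      ∀ y ∈ Metric.closedBall c R, y ≠ x → y ∈ U := by
  set g := gradient ρ x with hg
  have hg0 : 0 < ‖g‖ := norm_pos_iff.2 h.gradient_ne_zero
  have hD : ContDiffAt ℝ 1 (fderiv ℝ ρ) x := h.contDiffAt.fderiv_right (by norm_num)
  obtain ⟨L, t, ht, hL⟩ := hD.exists_lipschitzOnWith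
  have hdiff : ∀ᶠ y in 𝓝 x, DifferentiableAt ℝ ρ y :=
    (h.contDiffAt.eventually (by simp)).mono fun y hy ↦ hy.differentiableAt (by simp)
  obtain ⟨r, hr, hball⟩ := Metric.mem_nhds_iff.1
    (inter_mem (inter_mem ht hdiff) (inter_mem h.mem_iff hW))
  have htaylor : ∀ y ∈ Metric.ball x r, ρ y ≤ inner ℝ g (y - x) + L * ‖y - x‖ ^ 2 := by
    intro y hy
    have hsub : Metric.closedBall x ‖y - x‖ ⊆ Metric.ball x r :=
      Metric.closedBall_subset_ball (by simpa [dist_eq_norm] using hy)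
    have := (convex_closedBall x ‖y - x‖).norm_image_sub_le_of_norm_hasFDerivWithin_le
      (f := fun z ↦ ρ z - fderiv ℝ ρ x z) (f' := fun z ↦ fderiv ℝ ρ z - fderiv ℝ ρ x)
      (C := L * ‖y - x‖) (fun z hz ↦
        (((hball (hsub hz)).1.2.hasFDerivAt).sub (fderiv ℝ ρ x).hasFDerivAt).hasFDerivWithinAt)
      (fun z hz ↦ by
        have h1 := hL.dist_le_mul z (hball (hsub hz)).1.1 x (hball (Metric.mem_ball_self hr)).1.1
        rw [dist_eq_norm, dist_eq_norm] at h1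
        refine h1.trans (mul_le_mul_of_nonneg_left ?_ L.2)
        simpa [dist_eq_norm] using hz)
      (Metric.mem_closedBall_self (norm_nonneg _)) (y := y) (by simp [dist_eq_norm])
    rw [h.eq_zero] at this
    have h2 := (le_abs_self _).trans this
    rw [hg, inner_gradient_left, map_sub]
    nlinarith
  -- On the ball `‖y - x‖² ≤ -2R⟨g, y - x⟩/‖g‖`, so a small `R` makes the linear term win.
  obtain ⟨R, hR, hRr, hRL⟩ : ∃ R : ℝ, 0 < R ∧ 2 * R < r ∧ 2 * R * L < ‖g‖ := by
    refine ⟨min (r / 4) (‖g‖ / (4 * (L + 1))), by positivity, ?_, ?_⟩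
    · have := min_le_left (r / 4) (‖g‖ / (4 * (L + 1)))
      linarith
    · have h1 := min_le_right (r / 4) (‖g‖ / (4 * (L + 1)))
      have hL0 : (0 : ℝ) ≤ L := L.2
      rw [le_div_iff₀ (by positivity)] at h1
      have h2 : 0 < min (r / 4) (‖g‖ / (4 * (L + 1))) := by positivity
      nlinarith
  have hnc : ‖R • (‖g‖⁻¹ • g)‖ = R := by
    rw [norm_smul, norm_smul, norm_inv, norm_norm, inv_mul_cancel₀ hg0.ne', mul_one,
      Real.norm_of_nonneg hR.le]
  have hyx : ∀ y ∈ Metric.closedBall (x - R • (‖g‖⁻¹ • g)) R, y ∈ Metric.ball x r := by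
    intro y hy
    rw [mem_closedBall_iff_norm] at hy
    rw [mem_ball_iff_norm]
    have : y - x = (y - (x - R • (‖g‖⁻¹ • g))) - R • (‖g‖⁻¹ • g) := by abel
    rw [this]
    linarith [norm_sub_le (y - (x - R • (‖g‖⁻¹ • g))) (R • (‖g‖⁻¹ • g))]
  refine ⟨x - R • (‖g‖⁻¹ • g), R, hR, by rw [sub_sub_cancel, hnc], ?_, ?_⟩
  · intro y hy
    exact (hball (hyx y hy)).2.2
  · intro y hy hne
    have hyx := hyx y hy
    have h1 := htaylor y hyx
    have h2 : ‖y - x‖ ^ 2 + 2 * (R * (‖g‖⁻¹ * inner ℝ g (y - x))) ≤ 0 := by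
      rw [mem_closedBall_iff_norm, show y - (x - R • (‖g‖⁻¹ • g)) = (y - x) + R • (‖g‖⁻¹ • g) by
        abel] at hy
      have h3 := pow_le_pow_left₀ (norm_nonneg _) hy 2
      rw [norm_add_sq_real, hnc, inner_smul_right, inner_smul_right, real_inner_comm] at h3
      linarith
    set q := ‖y - x‖ ^ 2 with hq
    set p := inner ℝ g (y - x) with hp
    have h4 : ‖g‖ * q ≤ -(2 * R * p) := by
      have := mul_le_mul_of_nonneg_left h2 hg0.le
      have h5 : ‖g‖ * (q + 2 * (R * (‖g‖⁻¹ * p))) = ‖g‖ * q + 2 * R * p := by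
        field_simp
      linarith
    have hq0 : 0 < q := pow_pos (norm_pos_iff.2 (sub_ne_zero.2 hne)) 2
    have : 2 * R * ρ y < 0 := by nlinarith
    exact ((hball hyx).2.1).2 (by nlinarith)

/-- The Hopf lemma: a critical point cannot lie on a `C²` part of the boundary of a superlevel set
of the arrival time `-u`. -/
lemma IsLevelSetSolution.gradient_ne_zero_of_isC2BoundaryPoint {f : (Fin n → ℝ) → ℝ}
    {K : Set (Fin n → ℝ)} {Ω : Set (Ambient n)} {u : Ambient n → ℝ} (hf : IsCurvatureFunction f K)
    (hu : IsLevelSetSolution f K Ω u) (hΩ : IsOpen Ω) {x : Ambient n} {t : ℝ} (hx : x ∈ Ω)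
    (hxt : u x = -t) (hb : IsC2BoundaryPoint {y ∈ Ω | u y < -t} x) : gradient u x ≠ 0 := by
  obtain ⟨ρ, hρ⟩ := hb
  obtain ⟨c, R, hR, hxc, hsub, hU⟩ := hρ.exists_closedBall (hΩ.mem_nhds hx)
  obtain ⟨σ, hσ, hσ1⟩ := exists_barrier_coeff f
  have hcont : ContinuousOn u (Metric.closedBall c R) := hu.continuousOn.mono
    (hsub.trans subset_closure)
  have hxB : x ∈ Metric.closedBall c R := by simp [dist_eq_norm, hxc]
  have hle : ∀ y ∈ Metric.closedBall c R, u y ≤ -t := by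
    intro y hy
    rcases eq_or_ne y x with rfl | hne
    · exact hxt.le
    · exact (hU y hy hne).2.le
  obtain ⟨y, hyB, hy⟩ := (isCompact_closedBall c R).exists_isMaxOn ⟨x, hxB⟩
    (f := fun y ↦ u y - σ * ‖y - c‖ ^ 2) (hcont.sub (by fun_prop))
  have hyR : ‖y - c‖ = R := by
    refine le_antisymm (by simpa [dist_eq_norm] using hyB) (not_lt.1 fun hlt ↦ ?_)
    exact hu.not_isLocalMax_sub_paraboloid hf hΩ (hsub hyB) hσ hσ1 (hy.isLocalMax
      (Metric.closedBall_mem_nhds_of_mem (by simpa [dist_eq_norm] using hlt)))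
  intro hg
  have hd : HasDerivAt (fun s : ℝ ↦ u (x + s • (c - x)) - σ * R ^ 2 * (1 - s) ^ 2)
      (2 * (σ * R ^ 2)) 0 := by
    have h1 : HasDerivAt (fun s : ℝ ↦ x + s • (c - x)) (c - x) 0 := by
      simpa using ((hasDerivAt_id (0 : ℝ)).smul_const (c - x)).const_add x
    have h2 : HasFDerivAt u (fderiv ℝ u x) (x + (0 : ℝ) • (c - x)) := by
      simpa using (hu.differentiableAt x (subset_closure hx)).hasFDerivAt
    have h3 := ((((hasDerivAt_id (0 : ℝ)).const_sub 1).pow 2).const_mul (σ * R ^ 2))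
    refine ((h2.comp_hasDerivAt 0 h1).sub h3).congr_deriv ?_
    rw [← inner_gradient_left, hg, inner_zero_left]
    simp
    ring
  have hneg := hd.nonpos_of_eventually_le (by
    filter_upwards [Ioo_mem_nhdsGT (zero_lt_one' ℝ)] with s hs
    have hn : ‖x + s • (c - x) - c‖ = (1 - s) * R := by
      rw [show x + s • (c - x) - c = (1 - s) • (x - c) by
        rw [sub_smul, one_smul, smul_sub, smul_sub]; abel, norm_smul, hxc,
        Real.norm_of_nonneg (by linarith [hs.2])]
    have h1 : u (x + s • (c - x)) - σ * ‖x + s • (c - x) - c‖ ^ 2 ≤ u y - σ * ‖y - c‖ ^ 2 := by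
      refine hy ?_
      rw [mem_closedBall_iff_norm, hn]
      nlinarith [hs.1]
    rw [hn, hyR] at h1
    have h2 := hle y hyB
    simp [hxt]
    nlinarith)
  have : 0 < σ * R ^ 2 := by positivity
  linarith

end Barrier

/-! ### The inner ball at the outer boundary -/

section OuterBoundary

open Filter Topology

/-- A segment leaving an open set has a first exit point, which lies on the frontier. -/
lemma exists_first_exit {V : Type*} [NormedAddCommGroup V] [NormedSpace ℝ V] {Ω : Set V}
    (hΩ : IsOpen Ω) {x y : V} (hx : x ∈ Ω) (hy : y ∉ Ω) :
    ∃ τ : ℝ, 0 < τ ∧ τ ≤ 1 ∧ x + τ • (y - x) ∈ frontier Ω ∧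
      ∀ s, 0 ≤ s → s < τ → x + s • (y - x) ∈ Ω := by
  have hcont : Continuous fun s : ℝ ↦ x + s • (y - x) := by fun_prop
  obtain ⟨τ, ⟨⟨h0, h1⟩, hτ⟩, hmin⟩ :=
    (isCompact_Icc.inter_right (hΩ.isClosed_compl.preimage hcont)).exists_isLeast
      (s := Set.Icc (0 : ℝ) 1 ∩ (fun s : ℝ ↦ x + s • (y - x)) ⁻¹' Ωᶜ) ⟨1, by simp, by simpa⟩
  have hτ0 : 0 < τ := lt_of_le_of_ne h0 fun h ↦ hτ (by simpa [← h])
  have hs : ∀ s, 0 ≤ s → s < τ → x + s • (y - x) ∈ Ω := fun s hs0 hsτ ↦ by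
    by_contra hn
    exact absurd (hmin ⟨⟨hs0, hsτ.le.trans h1⟩, hn⟩) (not_le.2 hsτ)
  refine ⟨τ, hτ0, h1, ?_, hs⟩
  rw [hΩ.frontier_eq]
  refine ⟨mem_closure_of_tendsto (f := fun s : ℝ ↦ x + s • (y - x)) (b := 𝓝[<] τ)
    (hcont.continuousAt.tendsto.mono_left nhdsWithin_le_nhds) ?_, hτ⟩
  filter_upwards [Ioo_mem_nhdsLT hτ0] with s h
  exact hs s h.1.le h.2

variable {n : ℕ} {f : (Fin n → ℝ) → ℝ} {K : Set (Fin n → ℝ)} {Ω : Set (Ambient n)}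
  {u ρ : Ambient n → ℝ} {x : Ambient n} {δ : ℝ}

lemma DifferentiableAt.hasDerivAt_line {V : Type*} [NormedAddCommGroup V] [NormedSpace ℝ V]
    {φ : V → ℝ} {x : V} (h : DifferentiableAt ℝ φ x) (v : V) :
    HasDerivAt (fun t : ℝ ↦ φ (x + t • v)) (fderiv ℝ φ x v) 0 := by
  have h1 : HasDerivAt (fun s : ℝ ↦ x + s • v) v 0 := by
    simpa using ((hasDerivAt_id (0 : ℝ)).smul_const v).const_add x
  have h2 : HasFDerivAt φ (fderiv ℝ φ x) (x + (0 : ℝ) • v) := by simpa using h.hasFDerivAt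
  exact h2.comp_hasDerivAt 0 h1

lemma tendsto_line {V : Type*} [NormedAddCommGroup V] [NormedSpace ℝ V] (x v : V) :
    Tendsto (fun t : ℝ ↦ x + t • v) (𝓝 0) (𝓝 x) := by
  have : Continuous fun t : ℝ ↦ x + t • v := by fun_prop
  simpa using this.tendsto 0

namespace IsLocalDefiningFunction

lemma differentiableAt (hρ : IsLocalDefiningFunction Ω ρ x) : DifferentiableAt ℝ ρ x :=
  hρ.contDiffAt.differentiableAt (by simp)

lemma eventually_mem (hρ : IsLocalDefiningFunction Ω ρ x) {v : Ambient n}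
    (hv : fderiv ℝ ρ x v < 0) : ∀ᶠ t in 𝓝[>] (0 : ℝ), x + t • v ∈ Ω := by
  have h1 := (hρ.differentiableAt.hasDerivAt_line v).neg.eventually_lt_of_pos (by simpa using hv)
  have h2 := ((tendsto_line x v).eventually hρ.mem_iff).filter_mono
    (nhdsWithin_le_nhds (s := Set.Ioi 0))
  filter_upwards [h1, h2] with t ht1 ht2
  rw [ht2]
  simpa [hρ.eq_zero] using ht1

/-- The gradient of `u` is a positive multiple of that of a defining function. -/
lemma exists_fderiv_eq_smul (hρ : IsLocalDefiningFunction Ω ρ x) (hu : DifferentiableAt ℝ u x)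
    (hx0 : u x = 0) (hneg : ∀ y ∈ Ω, u y < 0) (hg : gradient u x ≠ 0) :
    ∃ c : ℝ, 0 < c ∧ fderiv ℝ u x = c • fderiv ℝ ρ x := by
  have hρ0 : (-fderiv ℝ ρ x : Ambient n →L[ℝ] ℝ).toLinearMap ≠ 0 := by
    have := fderiv_ne_zero_iff_gradient_ne_zero.2 hρ.gradient_ne_zero
    intro h
    refine this (ContinuousLinearMap.ext fun v ↦ ?_)
    simpa using congrArg (fun T ↦ T v) h
  obtain ⟨c, hc, h⟩ := exists_multiplier (fderiv ℝ u x).toLinearMap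
    (-fderiv ℝ ρ x : Ambient n →L[ℝ] ℝ).toLinearMap hρ0 fun v hv ↦ by
      refine (hu.hasDerivAt_line v).nonpos_of_eventually_le ?_
      filter_upwards [hρ.eventually_mem (v := v) (by simpa using hv)] with t ht
      simpa [hx0] using (hneg _ ht).le
  have he : fderiv ℝ u x = c • fderiv ℝ ρ x := ContinuousLinearMap.ext fun v ↦ by simpa using h v
  refine ⟨c, lt_of_le_of_ne hc fun h0 ↦ ?_, he⟩
  exact fderiv_ne_zero_iff_gradient_ne_zero.2 hg (by rw [he, ← h0, zero_smul])

/-- Near a noncritical boundary point `u` is nonnegative outside `Ω`: it increases in the direction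
of its gradient, and vanishes where the boundary is crossed. -/
lemma eventually_nonneg (hρ : IsLocalDefiningFunction Ω ρ x) (hΩ : IsOpen Ω)
    (hu : ContDiffAt ℝ 2 u x) (hx0 : u x = 0) (hneg : ∀ y ∈ Ω, u y < 0)
    (hfr : ∀ y ∈ frontier Ω, u y = 0) (hg : gradient u x ≠ 0) :
    ∀ᶠ y in 𝓝 x, y ∉ Ω → 0 ≤ u y := by
  obtain ⟨c, hc, hcu⟩ := hρ.exists_fderiv_eq_smul (hu.differentiableAt (by simp)) hx0 hneg hg
  set g := gradient u x with hgdef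
  have hgg : 0 < fderiv ℝ u x g := by
    rw [← inner_gradient_left, ← hgdef]
    exact real_inner_self_pos.2 hg
  have hcont : ContinuousAt (fun y ↦ fderiv ℝ u y g) x := by
    have : ContinuousAt (fderiv ℝ u) x :=
      (hu.fderiv_right (m := 1) (by norm_num)).continuousAt
    fun_prop
  have hdiff : ∀ᶠ y in 𝓝 x, DifferentiableAt ℝ u y :=
    (hu.eventually (by simp)).mono fun y hy ↦ hy.differentiableAt (by simp)
  obtain ⟨r, hr, hball⟩ := Metric.mem_nhds_iff.1
    ((hcont.eventually (lt_mem_nhds hgg)).and hdiff)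
  -- A point `x - s g` of `Ω` below `x`.
  obtain ⟨s, hs0, hsΩ, hsr⟩ :
      ∃ s : ℝ, 0 < s ∧ x + s • (-g) ∈ Ω ∧ x + s • (-g) ∈ Metric.ball x r := by
    have h1 : fderiv ℝ ρ x (-g) < 0 := by
      have : fderiv ℝ u x g = c * fderiv ℝ ρ x g := by rw [hcu]; simp
      rw [map_neg]
      have := pos_of_mul_pos_right (this ▸ hgg) hc.le
      linarith
    obtain ⟨s, ⟨h1, h2⟩, h3⟩ := (((hρ.eventually_mem h1).and
      (((tendsto_line x (-g)).mono_left nhdsWithin_le_nhds).eventually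
        (Metric.ball_mem_nhds x hr))).and self_mem_nhdsWithin).exists
    exact ⟨s, h3, h1, h2⟩
  have hshift : Tendsto (fun y ↦ y + s • (-g)) (𝓝 x) (𝓝 (x + s • (-g))) :=
    (continuous_id.add continuous_const).tendsto x
  filter_upwards [Metric.ball_mem_nhds x hr, hshift.eventually (hΩ.mem_nhds hsΩ),
    hshift.eventually (Metric.isOpen_ball.mem_nhds hsr)] with y hy1 hy2 hy3 hyΩ
  obtain ⟨τ, hτ0, hτ1, hτ, -⟩ := exists_first_exit hΩ hy2 hyΩ
  set y' := y + s • -g + τ • (y - (y + s • -g)) with hy'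
  have hyy' : y - y' = ((1 - τ) * s) • g := by
    rw [hy']
    simp only [smul_neg, sub_add_cancel_left, neg_neg, mul_smul, sub_smul, one_smul]
    abel
  have hy'B : y' ∈ Metric.ball x r := by
    have := (convex_ball x r) hy3 hy1 (show 0 ≤ 1 - τ by linarith) hτ0.le (by ring)
    convert this using 1
    rw [hy', sub_smul, one_smul, smul_sub]
    abel
  obtain ⟨w, hw, hwe⟩ := domain_mvt (fun z hz ↦ (hball hz).2.hasFDerivAt.hasFDerivWithinAt)
    (convex_ball x r) hy'B hy1
  have hwB := (convex_ball x r).segment_subset hy'B hy1 hw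
  rw [hfr _ hτ, hyy', map_smul, smul_eq_mul, sub_zero] at hwe
  rw [hwe]
  have := (hball hwB).1
  have h3 : 0 ≤ (1 - τ) * s := mul_nonneg (by linarith) hs0.le
  exact mul_nonneg h3 (le_of_lt this)

/-- The second fundamental form of the zero set of `u` is not smaller than that of `∂Ω`. It is
compared along parabolas which curve out of `Ω`. -/
lemma smul_fderiv_fderiv_le (hρ : IsLocalDefiningFunction Ω ρ x) (hΩ : IsOpen Ω)
    (hu : ContDiffAt ℝ 2 u x) (hx0 : u x = 0) (hneg : ∀ y ∈ Ω, u y < 0)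
    (hfr : ∀ y ∈ frontier Ω, u y = 0) (hg : gradient u x ≠ 0) {c : ℝ} (hc : 0 < c)
    (hcu : fderiv ℝ u x = c • fderiv ℝ ρ x) {v : Ambient n} (hv : fderiv ℝ ρ x v = 0) :
    c * fderiv ℝ (fderiv ℝ ρ) x v v ≤ fderiv ℝ (fderiv ℝ u) x v v := by
  have hout := hρ.eventually_nonneg hΩ hu hx0 hneg hfr hg
  have hg' : fderiv ℝ ρ x (gradient ρ x) ≠ 0 := by
    rw [← inner_gradient_left]
    exact (real_inner_self_pos.2 hρ.gradient_ne_zero).ne'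
  have key : ∀ s : ℝ, 0 < fderiv ℝ (fderiv ℝ ρ) x v v + 2 * s →
      0 ≤ fderiv ℝ (fderiv ℝ u) x v v + 2 * (c * s) := by
    intro s hs
    set η := (s / fderiv ℝ ρ x (gradient ρ x)) • gradient ρ x with hη
    have hρη : fderiv ℝ ρ x η = s := by
      rw [hη, map_smul, smul_eq_mul, div_mul_cancel₀ _ hg']
    obtain ⟨h1, h2⟩ := hρ.contDiffAt.hasDerivAt_quadratic_curve v η
    obtain ⟨h3, h4⟩ := hu.hasDerivAt_quadratic_curve v η
    have hmin := isLocalMin_of_second_deriv_pos h1 h2 (by simp [hv]) (by rwa [hρη])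
    have hγ := tendsto_quadratic_curve x v η
    have hmin' : IsLocalMin (fun t : ℝ ↦ u (x + t • v + t ^ 2 • η)) 0 := by
      filter_upwards [hmin, hγ.eventually hρ.mem_iff, hγ.eventually hout] with t ht1 ht2 ht3
      simp [hρ.eq_zero] at ht1
      simp [hx0]
      exact ht3 fun h ↦ absurd (ht2.1 h) (not_lt.2 ht1)
    have := second_deriv_nonneg_of_isLocalMin h3 h4 hmin'
    rwa [hcu, _root_.smul_apply, hρη, smul_eq_mul] at this
  refine le_of_forall_pos_le_add fun ε hε ↦ ?_
  have := key (-(fderiv ℝ (fderiv ℝ ρ) x v v) / 2 + ε / (2 * c)) (by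
    have : 0 < ε / (2 * c) := by positivity
    linarith)
  have h2 : 2 * (c * (-(fderiv ℝ (fderiv ℝ ρ) x v v) / 2 + ε / (2 * c))) =
      -(c * fderiv ℝ (fderiv ℝ ρ) x v v) + ε := by field_simp
  linarith

end IsLocalDefiningFunction

/-- At a noncritical boundary point of `Ω` a frame of the tangent space is a limit of principal
frames at interior points, so the equation passes to the limit. -/
lemma IsLevelSetSolution.exists_frame_of_mem_closure (hf : IsCurvatureFunction f K)
    (hu : IsLevelSetSolution f K Ω u) (hx : x ∈ closure Ω) (hg : gradient u x ≠ 0) :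
    ∃ e : Fin n → Ambient n, Orthonormal ℝ e ∧ (∀ i, inner ℝ (e i) (gradient u x) = 0) ∧
      ((fun i ↦ fderiv ℝ (fderiv ℝ u) x (e i) (e i)) ∈ K →
        f (fun i ↦ fderiv ℝ (fderiv ℝ u) x (e i) (e i)) = 1) := by
  have hu3 := hu.contDiffAt hx hg 3
  have h2 : ContDiffAt ℝ 2 (fderiv ℝ u) x := hu3.fderiv_right (by norm_num)
  have h1 : ContDiffAt ℝ 1 (fderiv ℝ (fderiv ℝ u)) x := h2.fderiv_right (by norm_num)
  have hgc : ContinuousAt (gradient u) x := by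
    have := h2.continuousAt
    exact (InnerProductSpace.toDual ℝ (Ambient n)).symm.continuous.continuousAt.comp this
  obtain ⟨y, hyΩ, hy⟩ := mem_closure_iff_seq_limit.1 hx
  have hev : ∀ᶠ k in atTop, gradient u (y k) ≠ 0 :=
    (hgc.tendsto.comp hy).eventually (isOpen_ne.mem_nhds hg)
  obtain ⟨N, hN⟩ := eventually_atTop.1 hev
  choose A e hA hA1 he heg heA using fun k ↦
    hu.exists_frame hf (hyΩ (N + k)) (hN (N + k) (Nat.le_add_right _ _))
  obtain ⟨e', -, φ, hφ, hlim⟩ := (isCompact_closedBall (0 : Fin n → Ambient n) 1).tendsto_subseq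
    (x := e) fun k ↦ by
      rw [mem_closedBall_zero_iff, pi_norm_le_iff_of_nonneg zero_le_one]
      exact fun i ↦ ((he k).1 i).le
  have hlimi : ∀ i, Tendsto (fun k ↦ e (φ k) i) atTop (𝓝 (e' i)) := fun i ↦
    (tendsto_pi_nhds.1 hlim) i
  have hylim : Tendsto (fun k ↦ y (N + φ k)) atTop (𝓝 x) :=
    hy.comp (tendsto_atTop_mono (fun k ↦ Nat.le_add_left _ _) hφ.tendsto_atTop)
  refine ⟨e', ?_, fun i ↦ ?_, fun hK ↦ ?_⟩
  · rw [orthonormal_iff_ite]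
    intro i j
    have := (hlimi i).inner (𝕜 := ℝ) (hlimi j)
    simp_rw [orthonormal_iff_ite.1 (he _) i j] at this
    exact (tendsto_nhds_unique this tendsto_const_nhds)
  · have := (hlimi i).inner (𝕜 := ℝ) (hgc.tendsto.comp hylim)
    simp only [Function.comp_apply, heg] at this
    exact (tendsto_nhds_unique this tendsto_const_nhds)
  · have hAlim : Tendsto (fun k ↦ A (φ k)) atTop
        (𝓝 fun i ↦ fderiv ℝ (fderiv ℝ u) x (e' i) (e' i)) := by
      rw [tendsto_pi_nhds]
      intro i
      have hD : Tendsto (fun k ↦ fderiv ℝ (fderiv ℝ u) (y (N + φ k))) atTop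
          (𝓝 (fderiv ℝ (fderiv ℝ u) x)) := h1.continuousAt.tendsto.comp hylim
      have hc : Continuous fun p : (Ambient n →L[ℝ] Ambient n →L[ℝ] ℝ) × Ambient n ↦
        p.1 p.2 p.2 := by fun_prop
      have := (hc.tendsto _).comp (hD.prodMk_nhds (hlimi i))
      simpa [Function.comp_def, heA] using this
    have := (hf.differentiableAt hK).continuousAt.tendsto.comp hAlim
    simp only [Function.comp_def, hA1] at this
    exact (tendsto_nhds_unique this tendsto_const_nhds)

/-- The Andrews condition for `∂Ω`, read as a condition on the gradient of `u`. -/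
lemma IsLevelSetSolution.ball_subset_of_andrewsAt (hf : IsCurvatureFunction f K)
    (hu : IsLevelSetSolution f K Ω u) (hΩ : IsOpen Ω) (hΩb : Bornology.IsBounded Ω) (hδ : 0 < δ)
    (hx : x ∈ frontier Ω) (hA : AndrewsAt f K δ Ω x) (hg : gradient u x ≠ 0) :
    Metric.ball (x - δ • gradient u x) (δ * ‖gradient u x‖) ⊆ Ω := by
  obtain ⟨ρ, hρ, κ, ⟨hρg, e, he, heg, heB⟩, hκ, hball⟩ := hA
  have hxc := frontier_subset_closure hx
  have hneg : ∀ y ∈ Ω, u y < 0 := fun y hy ↦ hu.neg_of_mem hf hΩ hΩb hy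
  have hx0 := hu.boundary x hx
  obtain ⟨c, hc, hcu⟩ := hρ.exists_fderiv_eq_smul (hu.differentiableAt x hxc) hx0 hneg hg
  have hcg : gradient u x = c • gradient ρ x := by
    rw [gradient, gradient, hcu, map_smulₛₗ]
    rfl
  obtain ⟨e', he', heg', hK⟩ := hu.exists_frame_of_mem_closure hf hxc hg
  have hρpos : 0 < ‖gradient ρ x‖ := norm_pos_iff.2 hρg
  have heg'' : ∀ i, inner ℝ (e' i) (gradient ρ x) = 0 := fun i ↦ by
    have := heg' i
    rw [hcg, inner_smul_right] at this
    exact (mul_eq_zero.1 this).resolve_left hc.ne'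
  obtain ⟨hμ, hμle⟩ := hf.diag_of_frame (hf.smul_mem κ hκ _ hρpos) (fderiv ℝ (fderiv ℝ ρ) x) hρg
    he heg (fun i j ↦ by
      have := heB i j
      rw [div_eq_iff hρpos.ne'] at this
      rw [this]
      split_ifs <;> simp [mul_comm]) he' heg''
  rw [hf.homogeneous κ hκ _ hρpos] at hμle
  obtain ⟨hAK, hAle⟩ := hf.mono (hf.smul_mem _ hμ c hc)
    (μ := fun i ↦ fderiv ℝ (fderiv ℝ u) x (e' i) (e' i)) fun i ↦ by
      refine hρ.smul_fderiv_fderiv_le hΩ (hu.contDiffAt hxc hg 2) hx0 hneg hu.boundary hg hc hcu ?_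
      rw [← inner_gradient_left, real_inner_comm]
      exact heg'' i
  rw [hK hAK, hf.homogeneous _ hμ c hc] at hAle
  have hgn : ‖gradient u x‖ = c * ‖gradient ρ x‖ := by
    rw [hcg, norm_smul, Real.norm_of_nonneg hc.le]
  have hfκ := hf.pos κ hκ
  -- `|∇u| f(κ) ≤ 1`, so the ball in question is contained in the given one.
  have hr : δ * ‖gradient u x‖ ≤ δ / f κ := by
    rw [le_div_iff₀ hfκ, mul_assoc, hgn, mul_assoc]
    have : c * (‖gradient ρ x‖ * f κ) ≤ 1 :=
      (mul_le_mul_of_nonneg_left hμle hc.le).trans hAle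
    nlinarith
  refine Set.Subset.trans (Metric.ball_subset_ball' ?_) hball
  have hcen : x - δ • gradient u x - (x + (δ / f κ) • -(‖gradient ρ x‖⁻¹ • gradient ρ x)) =
      (δ / f κ - δ * ‖gradient u x‖) • (‖gradient ρ x‖⁻¹ • gradient ρ x) := by
    rw [sub_smul, hgn, mul_smul, mul_smul, smul_inv_smul₀ hρpos.ne', hcg]
    simp only [smul_neg]
    abel
  have hunit : ‖‖gradient ρ x‖⁻¹ • gradient ρ x‖ = 1 := norm_smul_inv_norm (𝕜 := ℝ) hρg
  rw [dist_eq_norm, hcen, norm_smul, hunit, mul_one, Real.norm_of_nonneg (by linarith)]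
  linarith

end OuterBoundary

/-! ### First and second variation of the two-point function -/

section Variation

open Filter Topology

variable {V : Type*} [NormedAddCommGroup V] [InnerProductSpace ℝ V]

/-- The two-point function of the points `x` and `x + z`. In terms of the arrival time `w = -u` it
is `2⟨∇w x, z⟩ - (M + τ w x) (1 - p + p ‖z‖² / s)`, where the last factor is the tangent line at
`‖z‖² = s` of the normalised power `(‖z‖² / s) ^ p`. -/
noncomputable def twoPoint (u : V → ℝ) (M τ p s : ℝ) (x z : V) : ℝ :=
  -2 * fderiv ℝ u x z - (M - τ * u x) * (1 - p + p * (‖z‖ ^ 2 / s))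

/-- The first derivative of `twoPoint` in the direction `(ξ, ζ)`. -/
noncomputable def twoPointDeriv (u : V → ℝ) (M τ p s : ℝ) (ξ x z ζ : V) : ℝ :=
  -2 * (fderiv ℝ (fderiv ℝ u) x ξ z + fderiv ℝ u x ζ)
    + τ * fderiv ℝ u x ξ * (1 - p + p * (‖z‖ ^ 2 / s))
    - (M - τ * u x) * (p * (2 * inner ℝ z ζ / s))

lemma ContDiffAt.hasDerivAt_line {φ : V → ℝ} {x : V} (hφ : ContDiffAt ℝ 2 φ x) (ξ : V) :
    (∀ᶠ t in 𝓝 (0 : ℝ), HasDerivAt (fun t : ℝ ↦ φ (x + t • ξ)) (fderiv ℝ φ (x + t • ξ) ξ) t) ∧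
    HasDerivAt (fun t : ℝ ↦ fderiv ℝ φ (x + t • ξ) ξ) (fderiv ℝ (fderiv ℝ φ) x ξ ξ) 0 := by
  simpa using hφ.hasDerivAt_quadratic_curve ξ 0

lemma hasDerivAt_twoPoint {u : V → ℝ} {x : V} (hu : ContDiffAt ℝ 3 u x) (M τ p s : ℝ)
    (ξ z ζ k : V) :
    (∀ᶠ t in 𝓝 (0 : ℝ), HasDerivAt
      (fun t : ℝ ↦ twoPoint u M τ p s (x + t • ξ) (z + t • ζ + t ^ 2 • k))
      (twoPointDeriv u M τ p s ξ (x + t • ξ) (z + t • ζ + t ^ 2 • k) (ζ + (2 * t) • k)) t) ∧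
    (fderiv ℝ u x ξ = 0 → HasDerivAt
      (fun t : ℝ ↦ twoPointDeriv u M τ p s ξ (x + t • ξ) (z + t • ζ + t ^ 2 • k) (ζ + (2 * t) • k))
      (-2 * (fderiv ℝ (fderiv ℝ (fderiv ℝ u)) x ξ ξ z + 2 * fderiv ℝ (fderiv ℝ u) x ξ ζ
          + 2 * fderiv ℝ u x k)
        + τ * fderiv ℝ (fderiv ℝ u) x ξ ξ * (1 - p + p * (‖z‖ ^ 2 / s))
        - (M - τ * u x) * (p * (2 * (‖ζ‖ ^ 2 + 2 * inner ℝ z k) / s))) 0) := by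
  obtain ⟨hQ, hQ'⟩ := (hu.of_le (by norm_num) : ContDiffAt ℝ 2 u x).hasDerivAt_line ξ
  have hZ := hasDerivAt_quadratic_curve z ζ k
  have hζ : ∀ t : ℝ, HasDerivAt (fun t : ℝ ↦ ζ + (2 * t) • k) ((2 : ℝ) • k) t := fun t ↦ by
    simpa using (((hasDerivAt_id t).const_mul 2).smul_const k).const_add ζ
  have hX : ∀ t : ℝ, HasDerivAt (fun t : ℝ ↦ x + t • ξ) ξ t := fun t ↦ by
    simpa using ((hasDerivAt_id t).smul_const ξ).const_add x
  have h2 : ContDiffAt ℝ 2 (fderiv ℝ u) x := hu.fderiv_right (by norm_num)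
  have h1 : ContDiffAt ℝ 1 (fderiv ℝ (fderiv ℝ u)) x := h2.fderiv_right (by norm_num)
  have hD : ∀ᶠ t in 𝓝 (0 : ℝ), HasDerivAt (fun t : ℝ ↦ fderiv ℝ u (x + t • ξ))
      (fderiv ℝ (fderiv ℝ u) (x + t • ξ) ξ) t := by
    filter_upwards [(tendsto_line x ξ).eventually (h2.eventually (by simp))] with t ht
    exact (ht.differentiableAt (by simp)).hasFDerivAt.comp_hasDerivAt t (hX t)
  constructor
  · filter_upwards [hQ, hD] with t hQt hDt
    have hP := hDt.clm_apply (hZ t)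
    have hS := (hZ t).norm_sq
    refine ((hP.const_mul (-2)).sub (((hQt.const_mul τ).const_sub M).mul
      (((hS.div_const s).const_mul p).const_add (1 - p)))).congr_deriv ?_
    rw [twoPointDeriv]
    ring
  · intro hξ
    have hDD : HasDerivAt (fun t : ℝ ↦ fderiv ℝ (fderiv ℝ u) (x + t • ξ))
        (fderiv ℝ (fderiv ℝ (fderiv ℝ u)) x ξ) 0 := by
      have : HasFDerivAt (fderiv ℝ (fderiv ℝ u)) (fderiv ℝ (fderiv ℝ (fderiv ℝ u)) x)
          (x + (0 : ℝ) • ξ) := by simpa using (h1.differentiableAt (by simp)).hasFDerivAt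
      exact HasFDerivAt.comp_hasDerivAt (l := fderiv ℝ (fderiv ℝ u)) (f := fun t : ℝ ↦ x + t • ξ)
        (0 : ℝ) this (hX 0)
    have hA := ((hDD.clm_apply (hasDerivAt_const (0 : ℝ) ξ)).clm_apply (hZ 0)).add
      (hD.self_of_nhds.clm_apply (hζ 0))
    have hS := (((hZ 0).norm_sq).div_const s).const_mul p |>.const_add (1 - p)
    have hI := (((((hZ 0).inner ℝ (hζ 0)).const_mul 2).div_const s).const_mul p)
    have := ((hA.const_mul (-2)).add ((hQ'.const_mul τ).mul hS)).sub
      (((hQ.self_of_nhds.const_mul τ).const_sub M).mul hI)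
    refine this.congr_deriv ?_
    simp [hξ, inner_smul_right]
    ring

end Variation

section TwoPointMax

open Filter Topology

variable {n : ℕ} {f : (Fin n → ℝ) → ℝ} {K : Set (Fin n → ℝ)} {Ω : Set (Ambient n)}
  {u : Ambient n → ℝ} {x y : Ambient n} {M τ p s : ℝ}

/-- The pair `(x, y)`, at distance `√s`, is a maximum with value zero of the two-point function
among all pairs for which `y` is not strictly inside the superlevel set of `-u` through `x`. -/
structure IsTwoPointMax (Ω : Set (Ambient n)) (u : Ambient n → ℝ) (M τ p s : ℝ)
    (x y : Ambient n) : Prop where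
  mem : x ∈ Ω
  pair : y ∉ Ω ∨ u x ≤ u y
  le_zero : ∀ x' ∈ Ω, ∀ y', (y' ∉ Ω ∨ u x' ≤ u y') → twoPoint u M τ p s x' (y' - x') ≤ 0
  eq_zero : twoPoint u M τ p s x (y - x) = 0
  sq_eq : ‖y - x‖ ^ 2 = s
  sq_pos : 0 < s
  weight_pos : 0 < M - τ * u x

namespace IsTwoPointMax

lemma fderiv_apply (h : IsTwoPointMax Ω u M τ p s x y) :
    -2 * fderiv ℝ u x (y - x) = M - τ * u x := by
  have := h.eq_zero
  rw [twoPoint, h.sq_eq, div_self h.sq_pos.ne'] at this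
  linarith

lemma gradient_ne_zero (h : IsTwoPointMax Ω u M τ p s x y) : gradient u x ≠ 0 := fun hg ↦ by
  have := h.fderiv_apply
  rw [← inner_gradient_left, hg, inner_zero_left] at this
  linarith [h.weight_pos]

lemma twoPointDeriv_eq (h : IsTwoPointMax Ω u M τ p s x y) (ξ ζ : Ambient n) :
    twoPointDeriv u M τ p s ξ x (y - x) ζ =
      -2 * (fderiv ℝ (fderiv ℝ u) x ξ (y - x) + fderiv ℝ u x ζ) + τ * fderiv ℝ u x ξ
        - 2 * ((M - τ * u x) * p / s) * inner ℝ (y - x) ζ := by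
  rw [twoPointDeriv, h.sq_eq, div_self h.sq_pos.ne']
  ring

/-- The first variation in a direction in which the constraint persists is nonpositive. -/
lemma twoPointDeriv_nonpos (h : IsTwoPointMax Ω u M τ p s x y) (hΩ : IsOpen Ω)
    (hu : ContDiffAt ℝ 3 u x) {ξ η : Ambient n}
    (hev : ∀ᶠ t in 𝓝[>] (0 : ℝ), y + t • η ∉ Ω ∨ u (x + t • ξ) ≤ u (y + t • η)) :
    twoPointDeriv u M τ p s ξ x (y - x) (η - ξ) ≤ 0 := by
  have hd := (hasDerivAt_twoPoint hu M τ p s ξ (y - x) (η - ξ) 0).1.self_of_nhds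
  have hΩ' := ((tendsto_line x ξ).eventually (hΩ.mem_nhds h.mem)).filter_mono
    (nhdsWithin_le_nhds (s := Set.Ioi 0))
  have := hd.nonpos_of_eventually_le (by
    filter_upwards [hev, hΩ'] with t ht1 ht2
    have h1 := h.le_zero _ ht2 _ ht1
    have h2 : y + t • η - (x + t • ξ) = y - x + t • (η - ξ) := by rw [smul_sub]; abel
    rw [h2] at h1
    simpa [h.eq_zero] using h1)
  simpa using this

/-- If the constraint were inactive, moving `y` towards `x` would increase the two-point function,
because `p > 1 / 2`. -/
lemma not_eventually_pair (h : IsTwoPointMax Ω u M τ p s x y) (hΩ : IsOpen Ω)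
    (hu : ContDiffAt ℝ 3 u x) (hp : 1 / 2 < p) :
    ¬ ∀ᶠ y' in 𝓝 y, y' ∉ Ω ∨ u x ≤ u y' := fun hev ↦ by
  have := h.twoPointDeriv_nonpos hΩ hu (ξ := 0) (η := -(y - x)) (by
    have := ((tendsto_line y (-(y - x))).eventually hev).filter_mono
      (nhdsWithin_le_nhds (s := Set.Ioi 0))
    simpa using this)
  rw [h.twoPointDeriv_eq, sub_zero, inner_neg_right, real_inner_self_eq_norm_sq, h.sq_eq] at this
  have h1 := h.fderiv_apply
  have h2 : 2 * ((M - τ * u x) * p / s) * -s = -(2 * ((M - τ * u x) * p)) := by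
    field_simp [h.sq_pos.ne']
  rw [h2] at this
  simp only [map_zero, map_neg] at this
  have h3 := h.weight_pos
  simp at this
  rw [map_sub] at h1
  nlinarith

/-- The Lagrange multiplier rule. Comparing the radial components shows that the multiplier and the
gradient at `y` do not vanish. -/
lemma exists_multiplier (h : IsTwoPointMax Ω u M τ p s x y) (hf : IsCurvatureFunction f K)
    (hu : IsLevelSetSolution f K Ω u) (hΩ : IsOpen Ω) (hΩb : Bornology.IsBounded Ω)
    (hp : 1 / 2 < p) :
    y ∈ Ω ∧ u y = u x ∧ gradient u y ≠ 0 ∧ ∃ c : ℝ, 0 < c ∧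
      (∀ η, -2 * fderiv ℝ u x η - 2 * ((M - τ * u x) * p / s) * inner ℝ (y - x) η =
        -c * fderiv ℝ u y η) ∧
      ∀ ξ, fderiv ℝ u x ξ = 0 → fderiv ℝ (fderiv ℝ u) x ξ (y - x) =
        ((M - τ * u x) * p / s) * inner ℝ (y - x) ξ := by
  have hu3 := hu.contDiffAt (subset_closure h.mem) h.gradient_ne_zero 3
  have hyΩ : y ∈ Ω := by
    by_contra hy
    refine h.not_eventually_pair hΩ hu3 hp ?_
    by_cases hyc : y ∈ closure Ω
    · have hy0 : u y = 0 := hu.boundary y (by rw [hΩ.frontier_eq]; exact ⟨hyc, hy⟩)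
      have := (hu.differentiableAt y hyc).continuousAt.eventually
        (lt_mem_nhds (hy0.symm ▸ hu.neg_of_mem hf hΩ hΩb h.mem))
      exact this.mono fun y' hy' ↦ Or.inr hy'.le
    · filter_upwards [isClosed_closure.isOpen_compl.mem_nhds hyc] with y' hy'
      exact Or.inl fun h ↦ hy' (subset_closure h)
  have hdy := hu.differentiableAt y (subset_closure hyΩ)
  have hdx := hu.differentiableAt x (subset_closure h.mem)
  have huxy : u y = u x := by
    refine le_antisymm (not_lt.1 fun hlt ↦ ?_) (h.pair.resolve_left (not_not.2 hyΩ))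
    exact h.not_eventually_pair hΩ hu3 hp
      ((hdy.continuousAt.eventually (lt_mem_nhds hlt)).mono fun y' hy' ↦ Or.inr hy'.le)
  set q := (M - τ * u x) * p / s with hq
  let ℓ : (Ambient n × Ambient n) →ₗ[ℝ] ℝ :=
    { toFun := fun v ↦ twoPointDeriv u M τ p s v.1 x (y - x) (v.2 - v.1)
      map_add' := fun v w ↦ by
        simp only [h.twoPointDeriv_eq, Prod.fst_add, Prod.snd_add, map_add, map_sub,
          _root_.add_apply, inner_add_right, inner_sub_right]
        ring
      map_smul' := fun r v ↦ by
        simp only [h.twoPointDeriv_eq, Prod.smul_fst, Prod.smul_snd, map_smul, map_sub,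
          _root_.smul_apply, inner_smul_right, inner_sub_right, smul_eq_mul, RingHom.id_apply]
        ring }
  let g : (Ambient n × Ambient n) →ₗ[ℝ] ℝ :=
    (fderiv ℝ u y).toLinearMap ∘ₗ LinearMap.snd ℝ _ _ -
      (fderiv ℝ u x).toLinearMap ∘ₗ LinearMap.fst ℝ _ _
  have hg0 : g ≠ 0 := fun hg ↦ by
    refine fderiv_ne_zero_iff_gradient_ne_zero.2 h.gradient_ne_zero
      (ContinuousLinearMap.ext fun v ↦ ?_)
    simpa [g] using congrArg (fun T ↦ T (v, 0)) hg
  obtain ⟨c, hc, hℓ⟩ := _root_.exists_multiplier ℓ g hg0 fun v hv ↦ by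
    refine h.twoPointDeriv_nonpos hΩ hu3 ?_
    have hpos : 0 < fderiv ℝ u y v.2 - fderiv ℝ u x v.1 := by simpa [g] using hv
    have := ((hdy.hasDerivAt_line v.2).sub (hdx.hasDerivAt_line v.1)).eventually_lt_of_pos hpos
    filter_upwards [this] with t ht
    simp [huxy] at ht
    exact Or.inr ht.le
  have hη : ∀ η, -2 * fderiv ℝ u x η - 2 * q * inner ℝ (y - x) η = -c * fderiv ℝ u y η := by
    intro η
    have h1 : twoPointDeriv u M τ p s 0 x (y - x) (η - 0) =
        -c * (fderiv ℝ u y η - fderiv ℝ u x 0) :=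
      hℓ (0, η)
    rw [h.twoPointDeriv_eq] at h1
    simp at h1
    linarith
  have hξ : ∀ ξ, fderiv ℝ u x ξ = 0 → fderiv ℝ (fderiv ℝ u) x ξ (y - x) =
      q * inner ℝ (y - x) ξ := by
    intro ξ hξ
    have h1 : twoPointDeriv u M τ p s ξ x (y - x) (0 - ξ) =
        -c * (fderiv ℝ u y 0 - fderiv ℝ u x ξ) :=
      hℓ (ξ, 0)
    rw [h.twoPointDeriv_eq, zero_sub, map_neg, inner_neg_right, hξ, map_zero] at h1
    linarith
  have hne : c * fderiv ℝ u y (y - x) ≠ 0 := fun h0 ↦ by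
    have h1 := hη (y - x)
    rw [h.fderiv_apply, real_inner_self_eq_norm_sq, h.sq_eq] at h1
    have h2 : 2 * q * s = 2 * ((M - τ * u x) * p) := by
      rw [hq]
      field_simp [h.sq_pos.ne']
    have h3 := h.weight_pos
    nlinarith
  refine ⟨hyΩ, huxy, fun hg ↦ hne ?_, c, lt_of_le_of_ne hc fun h0 ↦ hne ?_, hη, hξ⟩
  · rw [← inner_gradient_left, hg, inner_zero_left, mul_zero]
  · rw [← h0, zero_mul]

/-- The second variation along a pair of tangent directions, with the second-order correction that
keeps the two points on the same level set. -/
lemma second_variation (h : IsTwoPointMax Ω u M τ p s x y) (hΩ : IsOpen Ω)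
    (hu : ContDiffAt ℝ 3 u x) (huy : ContDiffAt ℝ 2 u y) (huxy : u y = u x)
    (hg : gradient u y ≠ 0) {c : ℝ}
    (hc : ∀ η, -2 * fderiv ℝ u x η - 2 * ((M - τ * u x) * p / s) * inner ℝ (y - x) η =
      -c * fderiv ℝ u y η) {ξ η : Ambient n} (hξ : fderiv ℝ u x ξ = 0)
    (hη : fderiv ℝ u y η = 0) :
    -2 * fderiv ℝ (fderiv ℝ (fderiv ℝ u)) x ξ ξ (y - x)
      - 4 * fderiv ℝ (fderiv ℝ u) x ξ (η - ξ)
      - 2 * ((M - τ * u x) * p / s) * ‖η - ξ‖ ^ 2 + τ * fderiv ℝ (fderiv ℝ u) x ξ ξ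
      - c * (fderiv ℝ (fderiv ℝ u) x ξ ξ - fderiv ℝ (fderiv ℝ u) y η η) ≤ 0 := by
  have hg' : fderiv ℝ u y (gradient u y) ≠ 0 := by
    rw [← inner_gradient_left]
    exact (real_inner_self_pos.2 hg).ne'
  set q := (M - τ * u x) * p / s with hq
  set X := fderiv ℝ (fderiv ℝ u) x ξ ξ with hX
  set Y := fderiv ℝ (fderiv ℝ u) y η η with hY
  have key : ∀ r : ℝ, 0 < Y + 2 * r - X →
      -2 * fderiv ℝ (fderiv ℝ (fderiv ℝ u)) x ξ ξ (y - x)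
        - 4 * fderiv ℝ (fderiv ℝ u) x ξ (η - ξ)
        - 2 * q * ‖η - ξ‖ ^ 2 + τ * X - 2 * c * r ≤ 0 := by
    intro r hr
    set k := (r / fderiv ℝ u y (gradient u y)) • gradient u y with hk
    have hyk : fderiv ℝ u y k = r := by
      rw [hk, map_smul, smul_eq_mul, div_mul_cancel₀ _ hg']
    obtain ⟨h1, h2⟩ := huy.hasDerivAt_quadratic_curve η k
    obtain ⟨h3, h4⟩ := (hu.of_le (by norm_num) : ContDiffAt ℝ 2 u x).hasDerivAt_line ξ
    have hmin := isLocalMin_of_second_deriv_pos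
      (h := fun t : ℝ ↦ u (y + t • η + t ^ 2 • k) - u (x + t • ξ))
      (h₁ := fun t : ℝ ↦ fderiv ℝ u (y + t • η + t ^ 2 • k) (η + (2 * t) • k) -
        fderiv ℝ u (x + t • ξ) ξ)
      ((h1.and h3).mono fun t ht ↦ ht.1.sub ht.2) (h2.sub h4) (by simp [hξ, hη])
      (by rw [hyk]; exact hr)
    obtain ⟨h5, h6⟩ := hasDerivAt_twoPoint hu M τ p s ξ (y - x) (η - ξ) k
    have hmax : IsLocalMax
        (fun t : ℝ ↦ twoPoint u M τ p s (x + t • ξ) (y - x + t • (η - ξ) + t ^ 2 • k)) 0 := by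
      filter_upwards [hmin, (tendsto_line x ξ).eventually (hΩ.mem_nhds h.mem)] with t ht1 ht2
      have h7 : u (x + t • ξ) ≤ u (y + t • η + t ^ 2 • k) := by
        simp [huxy] at ht1
        exact ht1
      have h8 := h.le_zero _ ht2 _ (Or.inr h7)
      have h9 : y + t • η + t ^ 2 • k - (x + t • ξ) = y - x + t • (η - ξ) + t ^ 2 • k := by
        rw [smul_sub]; abel
      rw [h9] at h8
      simpa [h.eq_zero] using h8
    have h10 := second_deriv_nonpos_of_isLocalMax h5 (h6 hξ) hmax
    rw [h.sq_eq, div_self h.sq_pos.ne'] at h10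
    have h11 := hc k
    rw [hyk] at h11
    have h12 : (M - τ * u x) * (p * (2 * (‖η - ξ‖ ^ 2 + 2 * inner ℝ (y - x) k) / s)) =
        2 * q * ‖η - ξ‖ ^ 2 + 4 * q * inner ℝ (y - x) k := by
      rw [hq]
      ring
    rw [h12] at h10
    linarith
  refine le_of_forall_pos_le_add fun ε hε ↦ ?_
  have hc' : 0 < 2 * (|c| + 1) := by positivity
  have := key ((X - Y) / 2 + ε / (2 * (|c| + 1))) (by
    have : 0 < ε / (2 * (|c| + 1)) := by positivity
    linarith)
  have h2 : 2 * c * (ε / (2 * (|c| + 1))) ≤ ε := by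
    rw [← mul_div_assoc, div_le_iff₀ hc']
    nlinarith [le_abs_self c]
  linarith

end IsTwoPointMax

end TwoPointMax

/-! ### Rotated frames and the differentiated equation -/

section RotatedFrame

variable {V : Type*} [NormedAddCommGroup V] [InnerProductSpace ℝ V] {n : ℕ}

/-- The image of a vector orthogonal to the unit vector `ν` under the rotation which takes `ν` to
the unit vector `μ` and fixes the orthogonal complement of the two. With `-μ` in place of `μ` it is
the image under the reflection which exchanges `ν` and `μ`. -/
noncomputable def rotateFrame (ν μ v : V) : V :=
  v - (inner ℝ μ v / (1 + inner ℝ ν μ)) • (ν + μ)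

lemma inner_rotateFrame {ν μ v w : V} (hν : ‖ν‖ = 1) (hμ : ‖μ‖ = 1) (h : 1 + inner ℝ ν μ ≠ 0)
    (hv : inner ℝ v ν = 0) (hw : inner ℝ w ν = 0) :
    inner ℝ (rotateFrame ν μ v) (rotateFrame ν μ w) = inner ℝ v w := by
  have h1 : inner ℝ ν ν = 1 := by rw [real_inner_self_eq_norm_sq, hν, one_pow]
  have h2 : inner ℝ μ μ = 1 := by rw [real_inner_self_eq_norm_sq, hμ, one_pow]
  have h3 : inner ℝ v μ = inner ℝ μ v := real_inner_comm _ _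
  have h4 : inner ℝ μ ν = inner ℝ ν μ := real_inner_comm _ _
  have h5 : inner ℝ ν w = 0 := by rw [real_inner_comm, hw]
  simp only [rotateFrame, inner_sub_left, inner_sub_right, inner_smul_left, inner_smul_right,
    inner_add_left, inner_add_right, h1, h2, h3, h4, h5, hv, conj_trivial]
  field_simp
  ring

lemma inner_rotateFrame_normal {ν μ v : V} (hμ : ‖μ‖ = 1) (h : 1 + inner ℝ ν μ ≠ 0) :
    inner ℝ (rotateFrame ν μ v) μ = 0 := by
  have h2 : inner ℝ μ μ = 1 := by rw [real_inner_self_eq_norm_sq, hμ, one_pow]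
  rw [rotateFrame, inner_sub_left, inner_smul_left, inner_add_left, h2, real_inner_comm]
  simp only [conj_trivial]
  field_simp
  ring

lemma orthonormal_rotateFrame {ν μ : V} {e : Fin n → V} (he : Orthonormal ℝ e) (hν : ‖ν‖ = 1)
    (hμ : ‖μ‖ = 1) (h : 1 + inner ℝ ν μ ≠ 0) (heν : ∀ i, inner ℝ (e i) ν = 0) :
    Orthonormal ℝ fun i ↦ rotateFrame ν μ (e i) := by
  rw [orthonormal_iff_ite] at he ⊢
  intro i j
  rw [inner_rotateFrame hν hμ h (heν i) (heν j), he]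

lemma hasDerivAt_rotateFrame {ν v ν' : V} {N : ℝ → V} (hν : ‖ν‖ = 1) (hN : HasDerivAt N ν' 0)
    (hN0 : N 0 = ν) (hv : inner ℝ ν v = 0) :
    HasDerivAt (fun t ↦ rotateFrame ν (N t) v) (-(inner ℝ ν' v • ν)) 0 := by
  have h1 : inner ℝ ν ν = 1 := by rw [real_inner_self_eq_norm_sq, hν, one_pow]
  have hb := hN.inner ℝ (hasDerivAt_const (0 : ℝ) v)
  have hd := ((hasDerivAt_const (0 : ℝ) ν).inner ℝ hN).const_add 1
  have hne : 1 + inner ℝ ν (N 0) ≠ 0 := by rw [hN0, h1]; norm_num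
  refine (((hb.div hd hne).smul (hN.const_add ν)).const_sub v).congr_deriv ?_
  simp only [Pi.div_apply, hN0, hv, h1, inner_zero_left, inner_zero_right, zero_mul, zero_add,
    sub_zero, zero_div, zero_smul]
  rw [← two_smul ℝ ν, smul_smul]
  congr 2
  ring

end RotatedFrame

section DifferentiatedEquation

open Filter Topology

variable {n : ℕ} {f : (Fin n → ℝ) → ℝ} {K : Set (Fin n → ℝ)} {Ω : Set (Ambient n)}
  {u : Ambient n → ℝ} {x : Ambient n}

/-- Concavity of `f` compares the second fundamental forms at two points, in arbitrary frames at
the second one. -/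
lemma IsLevelSetSolution.sum_fderiv_mul_sub_nonneg (hf : IsCurvatureFunction f K)
    (hu : IsLevelSetSolution f K Ω u) {A : Fin n → ℝ} (hA : A ∈ K) (hA1 : f A = 1)
    (hx : x ∈ Ω) (hg : gradient u x ≠ 0) {e : Fin n → Ambient n} (he : Orthonormal ℝ e)
    (heg : ∀ i, inner ℝ (e i) (gradient u x) = 0) :
    0 ≤ ∑ i, fderiv ℝ f A (Pi.single i 1) * (fderiv ℝ (fderiv ℝ u) x (e i) (e i) - A i) := by
  obtain ⟨B, e', hB, hB1, he', heg', heB⟩ := hu.exists_frame hf hx hg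
  obtain ⟨h1, h2⟩ := hf.diag_of_frame hB (fderiv ℝ (fderiv ℝ u) x) hg he' heg' heB he heg
  have := hf.sub_le_fderiv hA h1
  linarith

lemma hasDerivAt_gradient_line (hu : ContDiffAt ℝ 2 u x) (z : Ambient n) :
    ∃ g', HasDerivAt (fun t : ℝ ↦ gradient u (x + t • z)) g' 0 ∧
      ∀ v, inner ℝ g' v = fderiv ℝ (fderiv ℝ u) x z v := by
  have h1 : ContDiffAt ℝ 1 (fderiv ℝ u) x := hu.fderiv_right (by norm_num)
  have hX : HasDerivAt (fun t : ℝ ↦ x + t • z) z 0 := by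
    simpa using ((hasDerivAt_id (0 : ℝ)).smul_const z).const_add x
  have hD : HasFDerivAt (fderiv ℝ u) (fderiv ℝ (fderiv ℝ u) x) (x + (0 : ℝ) • z) := by
    simpa using (h1.differentiableAt (by simp)).hasFDerivAt
  have h2 := hD.comp_hasDerivAt (0 : ℝ) hX
  let L : (Ambient n →L[ℝ] ℝ) →L[ℝ] Ambient n :=
    (InnerProductSpace.toDual ℝ (Ambient n)).symm.toContinuousLinearEquiv.toContinuousLinearMap
  refine ⟨L (fderiv ℝ (fderiv ℝ u) x z), L.hasFDerivAt.comp_hasDerivAt (0 : ℝ) h2, fun v ↦ ?_⟩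
  exact InnerProductSpace.toDual_symm_apply

/-- The derivative of the equation in the direction `z`. Only a first derivative of the equation is
available, since `f` is merely differentiable; it comes from the fact that by concavity the
linearised curvature function has a minimum at `x`, if the frame is moved along by rotations. -/
lemma IsLevelSetSolution.differentiated_equation (hf : IsCurvatureFunction f K)
    (hu : IsLevelSetSolution f K Ω u) (hΩ : IsOpen Ω) {A : Fin n → ℝ} (hA : A ∈ K)
    (hA1 : f A = 1) (hx : x ∈ Ω) (hg : gradient u x ≠ 0) {e : Fin n → Ambient n}
    (he : Orthonormal ℝ e) (heg : ∀ i, inner ℝ (e i) (gradient u x) = 0)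
    (heA : ∀ i j, fderiv ℝ (fderiv ℝ u) x (e i) (e j) = if i = j then A i else 0)
    (z : Ambient n) :
    ∑ i, fderiv ℝ f A (Pi.single i 1) * (fderiv ℝ (fderiv ℝ (fderiv ℝ u)) x z (e i) (e i)
      - 2 * (‖gradient u x‖⁻¹ * fderiv ℝ (fderiv ℝ u) x z (e i)) *
        fderiv ℝ (fderiv ℝ u) x (e i) (‖gradient u x‖⁻¹ • gradient u x)) = 0 := by
  have hu3 := hu.contDiffAt (subset_closure hx) hg 3
  have h2 : ContDiffAt ℝ 2 (fderiv ℝ u) x := hu3.fderiv_right (by norm_num)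
  have h1 : ContDiffAt ℝ 1 (fderiv ℝ (fderiv ℝ u)) x := h2.fderiv_right (by norm_num)
  have hu2 : ContDiffAt ℝ 2 u x := hu3.of_le (by norm_num)
  set r := ‖gradient u x‖ with hr
  have hrpos : 0 < r := norm_pos_iff.2 hg
  set ν := r⁻¹ • gradient u x with hν
  have hν1 : ‖ν‖ = 1 := norm_smul_inv_norm (𝕜 := ℝ) hg
  have heν : ∀ i, inner ℝ (e i) ν = 0 := fun i ↦ by rw [hν, inner_smul_right, heg, mul_zero]
  obtain ⟨g', hg', hg'v⟩ := hasDerivAt_gradient_line hu2 z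
  -- The unit normal along the line, and the frame rotated along with it.
  set N : ℝ → Ambient n := fun t ↦ ‖gradient u (x + t • z)‖⁻¹ • gradient u (x + t • z) with hNdef
  have hN0 : N 0 = ν := by simp [hNdef, hν, hr]
  have hnorm : DifferentiableAt ℝ (fun t : ℝ ↦ ‖gradient u (x + t • z)‖⁻¹) 0 := by
    refine (hg'.differentiableAt.norm ℝ ?_).inv ?_
    · simpa using hg
    · simpa using hg
  have hN := hnorm.hasDerivAt.smul hg'
  set ν' := ‖gradient u (x + (0 : ℝ) • z)‖⁻¹ • g' +
    deriv (fun t : ℝ ↦ ‖gradient u (x + t • z)‖⁻¹) 0 • gradient u (x + (0 : ℝ) • z) with hν'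
  have hν'e : ∀ i, inner ℝ ν' (e i) = r⁻¹ * fderiv ℝ (fderiv ℝ u) x z (e i) := by
    intro i
    rw [hν', inner_add_left, inner_smul_left, inner_smul_left, hg'v, zero_smul, add_zero,
      real_inner_comm, heg]
    simp [hr]
  have hε : ∀ i, HasDerivAt (fun t ↦ rotateFrame ν (N t) (e i))
      (-((r⁻¹ * fderiv ℝ (fderiv ℝ u) x z (e i)) • ν)) 0 := fun i ↦ by
    rw [← hν'e]
    exact hasDerivAt_rotateFrame hν1 hN hN0 (by rw [real_inner_comm]; exact heν i)
  have hε0 : ∀ i, rotateFrame ν (N 0) (e i) = e i := fun i ↦ by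
    rw [hN0, rotateFrame, real_inner_comm, heν, zero_div, zero_smul, sub_zero]
  have hDD : HasDerivAt (fun t : ℝ ↦ fderiv ℝ (fderiv ℝ u) (x + t • z))
      (fderiv ℝ (fderiv ℝ (fderiv ℝ u)) x z) 0 := by
    have h3 : HasFDerivAt (fderiv ℝ (fderiv ℝ u)) (fderiv ℝ (fderiv ℝ (fderiv ℝ u)) x)
        (x + (0 : ℝ) • z) := by simpa using (h1.differentiableAt (by simp)).hasFDerivAt
    have hX : HasDerivAt (fun t : ℝ ↦ x + t • z) z 0 := by
      simpa using ((hasDerivAt_id (0 : ℝ)).smul_const z).const_add x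
    exact HasFDerivAt.comp_hasDerivAt (l := fderiv ℝ (fderiv ℝ u)) (f := fun t : ℝ ↦ x + t • z)
      (0 : ℝ) h3 hX
  have hG : HasDerivAt (fun t : ℝ ↦ ∑ i, fderiv ℝ f A (Pi.single i 1) *
      (fderiv ℝ (fderiv ℝ u) (x + t • z) (rotateFrame ν (N t) (e i)) (rotateFrame ν (N t) (e i))
        - A i)) (∑ i, fderiv ℝ f A (Pi.single i 1) *
      (fderiv ℝ (fderiv ℝ (fderiv ℝ u)) x z (e i) (e i)
      - 2 * (r⁻¹ * fderiv ℝ (fderiv ℝ u) x z (e i)) * fderiv ℝ (fderiv ℝ u) x (e i) ν)) 0 := by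
    refine HasDerivAt.fun_sum fun i _ ↦ ?_
    refine ((((hDD.clm_apply (hε i)).clm_apply (hε i)).sub_const (A i)).const_mul _).congr_deriv ?_
    rw [hε0]
    simp only [zero_smul, add_zero, map_neg, map_smul, _root_.add_apply, _root_.neg_apply,
      _root_.smul_apply, smul_eq_mul, hu2.fderiv_fderiv_comm ν (e i)]
    ring
  have hmin : IsLocalMin (fun t : ℝ ↦ ∑ i, fderiv ℝ f A (Pi.single i 1) *
      (fderiv ℝ (fderiv ℝ u) (x + t • z) (rotateFrame ν (N t) (e i)) (rotateFrame ν (N t) (e i))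
        - A i)) 0 := by
    have hgc := hg'.continuousAt
    have hc1 : ∀ᶠ t : ℝ in 𝓝 0, gradient u (x + t • z) ≠ 0 :=
      hgc.eventually (isOpen_ne.mem_nhds (by simpa using hg))
    have hNc : ContinuousAt (fun t ↦ 1 + inner ℝ ν (N t)) 0 :=
      (continuousAt_const.inner hN.continuousAt).const_add 1
    have hc2 : ∀ᶠ t : ℝ in 𝓝 0, 1 + inner ℝ ν (N t) ≠ 0 := by
      refine hNc.eventually (isOpen_ne.mem_nhds ?_)
      change 1 + inner ℝ ν (N 0) ≠ 0
      rw [hN0, real_inner_self_eq_norm_sq, hν1]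
      norm_num
    filter_upwards [hc1, hc2, (tendsto_line x z).eventually (hΩ.mem_nhds hx)] with t ht1 ht2 ht3
    have hNt : ‖N t‖ = 1 := norm_smul_inv_norm (𝕜 := ℝ) ht1
    refine le_trans (le_of_eq ?_) (hu.sum_fderiv_mul_sub_nonneg hf hA hA1 ht3 ht1
      (orthonormal_rotateFrame he hν1 hNt ht2 heν) fun i ↦ ?_)
    · refine Finset.sum_eq_zero fun i _ ↦ ?_
      rw [hε0, zero_smul, add_zero, heA, if_pos rfl, sub_self, mul_zero]
    · have h4 := inner_rotateFrame_normal (v := e i) hNt ht2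
      have h5 : gradient u (x + t • z) = ‖gradient u (x + t • z)‖ • N t := by
        rw [hNdef, smul_inv_smul₀ (norm_ne_zero_iff.2 ht1)]
      rw [h5, inner_smul_right, h4, mul_zero]
  exact hmin.hasDerivAt_eq_zero hG

end DifferentiatedEquation

/-! ### The two-point maximum principle -/

section NoTwoPointMax

/-- Elementary geometry of the triangle with vertices `x`, `y` and the centre of the touching ball:
`R` and `S` are the distances of `x` and `y` from the centre and `c` is the cosine of the angle
between the normals. For `p` close to `1` the numbers `R` and `S` nearly agree, which fixes the
signs of the coefficients belonging to the rotation and to the reflection of the frames. -/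
lemma sign_of_coefficients {R S c p : ℝ} (hR : 0 < R) (hS : 0 < S) (hc : c ≤ 1) (hc' : -1 ≤ c)
    (hp : 9 / 10 ≤ p) (hp1 : p < 1) (hs : 0 < R ^ 2 + S ^ 2 - 2 * R * S * c)
    (h : R ^ 2 + S ^ 2 - 2 * R * S * c = 2 * p * R * (R - S * c)) :
    0 < R - S * c ∧ (0 < 1 + c → S * (S - R) / (R * (R - S * c)) - 1 / (1 + c) ≤ 0) ∧
      0 < 1 - c ∧ 0 ≤ S * (S + R) / (R * (R - S * c)) - 1 / (1 - c) := by
  have hpos : 0 < R - S * c := by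
    rw [h] at hs
    exact pos_of_mul_pos_right hs (by positivity)
  have hSR : S ≤ R := by
    by_contra! hlt
    have h1 : S ^ 2 = (2 * p - 1) * R ^ 2 + 2 * (1 - p) * R * S * c := by linarith
    have h2 : R * S * c ≤ R * S := by nlinarith [mul_pos hR hS]
    have h3 : (2 * p - 1) * (R * R) ≤ (2 * p - 1) * (R * S) :=
      mul_le_mul_of_nonneg_left (mul_le_mul_of_nonneg_left hlt.le hR.le) (by linarith)
    have h4 : (1 - p) * (R * S * c) ≤ (1 - p) * (R * S) :=
      mul_le_mul_of_nonneg_left h2 (by linarith)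
    have h5 : R * S < S * S := mul_lt_mul_of_pos_right hlt hS
    linarith
  have hc1 : 0 < 1 - c := by
    refine sub_pos.2 (lt_of_le_of_ne hc fun h1 ↦ ?_)
    rw [h1] at h hs hpos
    have h2 : (R - S) * (R - S - 2 * p * R) = 0 := by linarith
    rcases mul_eq_zero.1 h2 with h3 | h3
    · linarith
    · nlinarith
  refine ⟨hpos, fun h1 ↦ ?_, hc1, ?_⟩
  · have h2 : S * (S - R) / (R * (R - S * c)) ≤ 0 :=
      div_nonpos_of_nonpos_of_nonneg (by nlinarith) (by positivity)
    have h3 : 0 < 1 / (1 + c) := by positivity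
    linarith
  · rw [sub_nonneg, div_le_div_iff₀ hc1 (by positivity), one_mul]
    -- `d = R - S` is small compared with `S (1 - c)`.
    obtain ⟨d, rfl⟩ : ∃ d, R = S + d := ⟨R - S, by ring⟩
    have hd : 0 ≤ d := by linarith
    have h1 : d * (2 * S + d) = 2 * (1 - p) * (S + d) * (d + S * (1 - c)) := by linarith
    have h2 : 0 ≤ (S + d) * (d + S * (1 - c)) := by positivity
    have h3 : d * (S + d) ≤ (1 / 5) * ((S + d) * (d + S * (1 - c))) := by nlinarith
    have h4 : d ≤ S * (1 - c) / 4 := by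
      have h5 : (S + d) * d ≤ (S + d) * ((1 / 5) * (d + S * (1 - c))) := by linarith
      have := le_of_mul_le_mul_left h5 hR
      linarith
    have h5 : d ≤ S / 2 := by nlinarith
    have h6 : (S + d) * d ≤ (S + d) * (S * (1 - c) / 4) := mul_le_mul_of_nonneg_left h4 hR.le
    have h7 : 0 < S * (1 - c) := by positivity
    nlinarith

open Filter Topology

variable {n : ℕ} {f : (Fin n → ℝ) → ℝ} {K : Set (Fin n → ℝ)} {Ω : Set (Ambient n)}
  {u : Ambient n → ℝ} {x y : Ambient n} {M τ p s : ℝ}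

lemma clm_apply_eq_add_sum_frame {e : Fin n → Ambient n} (he : Orthonormal ℝ e) {ν : Ambient n}
    (hν : ‖ν‖ = 1) (heν : ∀ i, inner ℝ (e i) ν = 0) (T : Ambient n →L[ℝ] ℝ) (v : Ambient n) :
    T v = inner ℝ ν v * T ν + ∑ i, inner ℝ (e i) v * T (e i) := by
  conv_lhs => rw [eq_add_sum_frame he hν heν v]
  simp [map_sum]

/-- There is no interior maximum of the two-point function. The second variations along the
principal frame at `x` and its image at `y` under a rotation or a reflection are added with the
weights `∂f/∂κ_i`; the differentiated equation and concavity leave a multiple of a sum whose sign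
decides between the rotation and the reflection, and the term `τ ∑ (∂f/∂κ_i) A_i > 0`. -/
theorem not_isTwoPointMax (hf : IsCurvatureFunction f K) (hu : IsLevelSetSolution f K Ω u)
    (hΩ : IsOpen Ω) (hΩb : Bornology.IsBounded Ω) (hτ : 0 < τ) (hp : 9 / 10 ≤ p) (hp1 : p < 1) :
    ¬ IsTwoPointMax Ω u M τ p s x y := fun h ↦ by
  obtain ⟨hyΩ, huxy, hgy, l, hl, hη, hξ⟩ := h.exists_multiplier hf hu hΩ hΩb (by linarith)
  have hgx := h.gradient_ne_zero
  have hu3 := hu.contDiffAt (subset_closure h.mem) hgx 3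
  have hu2 : ContDiffAt ℝ 2 u x := hu3.of_le (by norm_num)
  obtain ⟨A, e, hA, hA1, he, heg, heA⟩ := hu.exists_frame hf h.mem hgx
  set q := (M - τ * u x) * p / s with hq
  set z := y - x with hz
  have hq0 : 0 < q := div_pos (mul_pos h.weight_pos (by linarith)) h.sq_pos
  set α := ‖gradient u x‖ with hα
  set β := ‖gradient u y‖ with hβ
  have hα0 : 0 < α := norm_pos_iff.2 hgx
  have hβ0 : 0 < β := norm_pos_iff.2 hgy
  set ν := α⁻¹ • gradient u x with hν
  set μ := β⁻¹ • gradient u y with hμ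
  have hν1 : ‖ν‖ = 1 := norm_smul_inv_norm (𝕜 := ℝ) hgx
  have hμ1 : ‖μ‖ = 1 := norm_smul_inv_norm (𝕜 := ℝ) hgy
  have hgν : gradient u x = α • ν := by rw [hν, smul_inv_smul₀ hα0.ne']
  have hgμ : gradient u y = β • μ := by rw [hμ, smul_inv_smul₀ hβ0.ne']
  have heν : ∀ i, inner ℝ (e i) ν = 0 := fun i ↦ by rw [hν, inner_smul_right, heg, mul_zero]
  have hDe : ∀ i, fderiv ℝ u x (e i) = 0 := fun i ↦ by
    rw [← inner_gradient_left, real_inner_comm, heg]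
  -- The position of `x` and `y` relative to the centre of the ball.
  set R := α / q with hR
  set S := l * β / (2 * q) with hS
  have hR0 : 0 < R := by positivity
  have hS0 : 0 < S := by positivity
  have hzv : ∀ v, inner ℝ z v = -(R * inner ℝ ν v) + S * inner ℝ μ v := by
    intro v
    have h1 := hη v
    have h5 : inner ℝ (gradient u x) v = α * inner ℝ ν v := by
      rw [hgν, inner_smul_left, conj_trivial]
    have h6 : inner ℝ (gradient u y) v = β * inner ℝ μ v := by
      rw [hgμ, inner_smul_left, conj_trivial]
    rw [← inner_gradient_left, ← inner_gradient_left, h5, h6] at h1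
    have h2 : R * q = α := by rw [hR]; field_simp
    have h3 : 2 * (S * q) = l * β := by rw [hS]; field_simp
    have h4 : q * inner ℝ z v = q * (-(R * inner ℝ ν v) + S * inner ℝ μ v) := by
      have : q * (-(R * inner ℝ ν v) + S * inner ℝ μ v) =
        -((R * q) * inner ℝ ν v) + (2 * (S * q)) * inner ℝ μ v / 2 := by ring
      rw [this, h2, h3]
      linarith
    exact mul_left_cancel₀ hq0.ne' h4
  set c := inner ℝ ν μ with hc
  have hνν : inner ℝ ν ν = 1 := by rw [real_inner_self_eq_norm_sq, hν1, one_pow]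
  have hμμ : inner ℝ μ μ = 1 := by rw [real_inner_self_eq_norm_sq, hμ1, one_pow]
  have hμν : inner ℝ μ ν = c := real_inner_comm _ _
  have hzν : inner ℝ z ν = -R + S * c := by rw [hzv, hνν, hμν]; ring
  have hzμ : inner ℝ z μ = -(R * c) + S := by rw [hzv, hμμ]; ring
  have hzz : inner ℝ z z = s := by rw [real_inner_self_eq_norm_sq, h.sq_eq]
  have hs1 : s = R ^ 2 + S ^ 2 - 2 * R * S * c := by
    rw [← hzz, hzv, real_inner_comm, hzν, real_inner_comm, hzμ]
    ring
  have hs2 : s = 2 * p * R * (R - S * c) := by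
    have h1 := h.fderiv_apply
    rw [← inner_gradient_left, ← hz, hgν, inner_smul_left, real_inner_comm, hzν] at h1
    simp only [conj_trivial] at h1
    have h2 : R * q = α := by rw [hR]; field_simp
    have h3 : q * s = (M - τ * u x) * p := by
      rw [hq]
      field_simp [h.sq_pos.ne']
    rw [← h1, ← h2] at h3
    have h4 : q * s = q * (2 * p * R * (R - S * c)) := by rw [h3]; ring
    exact mul_left_cancel₀ hq0.ne' h4
  have hcb := abs_le.1 (abs_real_inner_le_norm ν μ)
  rw [hν1, hμ1, one_mul] at hcb
  obtain ⟨hpos, hsgn1, hc1, hsgn2⟩ := sign_of_coefficients hR0 hS0 hcb.2 hcb.1 hp hp1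
    (hs1 ▸ h.sq_pos) (hs1.symm.trans hs2)
  -- The mixed components of the Hessian are determined by the first-order conditions.
  set b : Fin n → ℝ := fun i ↦ inner ℝ μ (e i) with hb
  set N : Fin n → ℝ := fun i ↦ fderiv ℝ (fderiv ℝ u) x (e i) ν with hN
  have hνe : ∀ i, inner ℝ ν (e i) = 0 := fun i ↦ by rw [real_inner_comm, heν]
  have hze : ∀ i, inner ℝ z (e i) = S * b i := fun i ↦ by rw [hzv, hνe]; ring
  have hHz : ∀ i, fderiv ℝ (fderiv ℝ u) x (e i) z = q * (S * b i) := fun i ↦ by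
    rw [hξ _ (hDe i), hze]
  have hHv : ∀ i v, fderiv ℝ (fderiv ℝ u) x (e i) v =
      inner ℝ ν v * N i + A i * inner ℝ (e i) v := by
    intro i v
    rw [clm_apply_eq_add_sum_frame he hν1 heν]
    simp [heA, hN, mul_comm]
  have hNb : ∀ i, N i * (R - S * c) = -(S * b i * (q - A i)) := by
    intro i
    have h1 := hHv i z
    rw [hHz, real_inner_comm, hzν, real_inner_comm, hze] at h1
    linarith
  set φ : Fin n → ℝ := fun i ↦ fderiv ℝ f A (Pi.single i 1) with hφ
  have hφA : 0 < ∑ i, φ i * A i := hf.sum_fderiv_mul_pos hA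
  have hdiff := hu.differentiated_equation hf hΩ hA hA1 h.mem hgx he heg heA z
  rw [← hα, ← hν] at hdiff
  have hdiff' : ∑ i, φ i * (fderiv ℝ (fderiv ℝ (fderiv ℝ u)) x z (e i) (e i)
      - 2 * (S / R) * (b i * N i)) = 0 := by
    rw [← hdiff]
    refine Finset.sum_congr rfl fun i _ ↦ ?_
    rw [hu2.fderiv_fderiv_comm z (e i), hHz]
    have : α⁻¹ * (q * (S * b i)) = S / R * b i := by
      rw [hR]
      field_simp
    rw [this]
    ring
  have main : ∀ σ : ℝ, (σ = 1 ∨ σ = -1) → 0 < 1 + σ * c →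
      4 * ((S * (S - σ * R) / (R * (R - S * c)) - 1 / (1 + σ * c)) *
        ∑ i, φ i * (b i ^ 2 * (q - A i))) + τ * ∑ i, φ i * A i ≤ 0 := by
    intro σ hσ hσc
    have hσσ : σ * σ = 1 := by rcases hσ with rfl | rfl <;> norm_num
    have hσμ1 : ‖σ • μ‖ = 1 := by
      rw [norm_smul, hμ1]
      rcases hσ with rfl | rfl <;> simp
    have hνσμ : inner ℝ ν (σ • μ) = σ * c := by rw [inner_smul_right]
    have hne : 1 + inner ℝ ν (σ • μ) ≠ 0 := by rw [hνσμ]; exact hσc.ne'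
    set ε : Fin n → Ambient n := fun i ↦ rotateFrame ν (σ • μ) (e i) with hε
    have hεo : Orthonormal ℝ ε := orthonormal_rotateFrame he hν1 hσμ1 hne heν
    have hεg : ∀ i, inner ℝ (ε i) (gradient u y) = 0 := fun i ↦ by
      have h1 : inner ℝ (ε i) (σ • μ) = 0 := inner_rotateFrame_normal hσμ1 hne
      have h2 : gradient u y = (β * σ) • (σ • μ) := by
        rw [smul_smul, mul_assoc, hσσ, mul_one, hgμ]
      rw [h2, inner_smul_right, h1, mul_zero]
    have hcomp := hu.sum_fderiv_mul_sub_nonneg hf hA hA1 hyΩ hgy hεo hεg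
    have hεe : ∀ i, ε i - e i = -((σ * b i / (1 + σ * c)) • (ν + σ • μ)) := fun i ↦ by
      simp only [hε, rotateFrame, hνσμ, inner_smul_left, conj_trivial, hb]
      abel
    have hνε : ∀ i, inner ℝ ν (ε i - e i) = -(σ * b i) := fun i ↦ by
      rw [hεe, inner_neg_right, inner_smul_right, inner_add_right, hνν, hνσμ]
      field_simp
    have heε : ∀ i, inner ℝ (e i) (ε i - e i) = -(b i ^ 2 / (1 + σ * c)) := fun i ↦ by
      rw [hεe, inner_neg_right, inner_smul_right, inner_add_right, heν, inner_smul_right,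
        real_inner_comm, zero_add]
      have : σ * b i / (1 + σ * c) * (σ * b i) = (σ * σ) * (b i ^ 2 / (1 + σ * c)) := by ring
      change -(σ * b i / (1 + σ * c) * (σ * b i)) = _
      rw [this, hσσ, one_mul]
    have hnε : ∀ i, ‖ε i - e i‖ ^ 2 = 2 * (b i ^ 2 / (1 + σ * c)) := fun i ↦ by
      have h1 : ‖ε i‖ ^ 2 = ‖e i + (ε i - e i)‖ ^ 2 := by rw [add_sub_cancel]
      rw [norm_add_sq_real, heε, hεo.1 i, he.1 i] at h1
      linarith
    have hvar : ∀ i, φ i * (-2 * fderiv ℝ (fderiv ℝ (fderiv ℝ u)) x z (e i) (e i)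
        - 4 * (-(σ * b i) * N i - A i * (b i ^ 2 / (1 + σ * c)))
        - 2 * q * (2 * (b i ^ 2 / (1 + σ * c))) + τ * A i
        - l * (A i - fderiv ℝ (fderiv ℝ u) y (ε i) (ε i))) ≤ 0 := by
      intro i
      refine mul_nonpos_of_nonneg_of_nonpos (hf.deriv_pos A hA i).le ?_
      have h1 := h.second_variation hΩ hu3 (hu.contDiffAt (subset_closure hyΩ) hgy 2) huxy hgy hη
        (hDe i) (η := ε i) (by rw [← inner_gradient_left, real_inner_comm, hεg])
      rw [← hz, hu3.fderiv_fderiv_fderiv_rotate, hHv, hνε, heε, hnε, heA, if_pos rfl] at h1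
      linarith
    have hsum := Finset.sum_nonpos fun i (_ : i ∈ Finset.univ) ↦ hvar i
    have hkey : ∀ i, φ i * (-2 * fderiv ℝ (fderiv ℝ (fderiv ℝ u)) x z (e i) (e i)
        - 4 * (-(σ * b i) * N i - A i * (b i ^ 2 / (1 + σ * c)))
        - 2 * q * (2 * (b i ^ 2 / (1 + σ * c))) + τ * A i
        - l * (A i - fderiv ℝ (fderiv ℝ u) y (ε i) (ε i))) =
        -2 * (φ i * (fderiv ℝ (fderiv ℝ (fderiv ℝ u)) x z (e i) (e i)
          - 2 * (S / R) * (b i * N i)))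
        + 4 * ((S * (S - σ * R) / (R * (R - S * c)) - 1 / (1 + σ * c)) *
          (φ i * (b i ^ 2 * (q - A i)))) + τ * (φ i * A i)
        + l * (φ i * (fderiv ℝ (fderiv ℝ u) y (ε i) (ε i) - A i)) := by
      intro i
      have h1 : N i = -(S * b i * (q - A i)) / (R - S * c) := by
        rw [eq_div_iff hpos.ne']
        exact hNb i
      rw [h1]
      have := hpos.ne'
      field_simp
      ring
    simp_rw [hkey, Finset.sum_add_distrib, ← Finset.mul_sum, hdiff'] at hsum
    have h2 : 0 ≤ l * ∑ i, φ i * (fderiv ℝ (fderiv ℝ u) y (ε i) (ε i) - A i) :=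
      mul_nonneg hl.le hcomp
    linarith
  have hτφ : 0 < τ * ∑ i, φ i * A i := mul_pos hτ hφA
  rcases lt_or_ge 0 (∑ i, φ i * (b i ^ 2 * (q - A i))) with hT | hT
  · have h1 := main (-1) (Or.inr rfl) (by linarith)
    have h2 : S * (S - -1 * R) / (R * (R - S * c)) - 1 / (1 + -1 * c) =
        S * (S + R) / (R * (R - S * c)) - 1 / (1 - c) := by ring_nf
    rw [h2] at h1
    have := mul_nonneg hsgn2 hT.le
    linarith
  · rcases lt_or_eq_of_le hcb.1 with hc2 | hc2
    · have h1 := main 1 (Or.inl rfl) (by linarith)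
      simp only [one_mul] at h1
      have := mul_nonneg_of_nonpos_of_nonpos (hsgn1 (by linarith)) hT
      linarith
    · -- Antipodal normals: both tangent spaces agree and all `b i` vanish.
      have h1 := main (-1) (Or.inr rfl) (by linarith)
      have hb0 : ∀ i, b i ^ 2 = 0 := by
        have h2 := norm_sq_eq_sum_frame he hν1 heν μ
        rw [hμμ, ← hc2] at h2
        have h3 : ∑ i, inner ℝ (e i) μ ^ 2 = 0 := by linarith
        rw [Finset.sum_eq_zero_iff_of_nonneg fun i _ ↦ sq_nonneg _] at h3
        intro i
        have := h3 i (Finset.mem_univ i)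
        rwa [real_inner_comm] at this
      simp only [hb0, zero_mul, mul_zero, Finset.sum_const_zero, zero_add] at h1
      linarith

end NoTwoPointMax

/-! ### The maximiser and the limit exponent -/

section GlobalEstimate

open Filter Topology

variable {n : ℕ} {f : (Fin n → ℝ) → ℝ} {K : Set (Fin n → ℝ)} {Ω : Set (Ambient n)}
  {u : Ambient n → ℝ} {x y : Ambient n} {δ : ℝ}

lemma notMem_ball_iff {g : Ambient n} (hδ : 0 < δ) :
    y ∉ Metric.ball (x - δ • g) (δ * ‖g‖) ↔ -2 * inner ℝ g (y - x) ≤ ‖y - x‖ ^ 2 / δ := by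
  have h1 : ‖y - (x - δ • g)‖ ^ 2 = ‖y - x‖ ^ 2 + 2 * δ * inner ℝ g (y - x) + (δ * ‖g‖) ^ 2 := by
    rw [show y - (x - δ • g) = (y - x) + δ • g by abel, norm_add_sq_real, inner_smul_right,
      real_inner_comm, norm_smul, Real.norm_of_nonneg hδ.le]
    ring
  rw [mem_ball_iff_norm, not_lt, ← pow_le_pow_iff_left₀ (by positivity) (norm_nonneg _) two_ne_zero,
    h1, le_div_iff₀ hδ]
  constructor <;> intro h <;> linarith

namespace IsLevelSetSolution

/-- The Andrews condition at the points of `∂Ω`, as an estimate for pairs of points. -/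
lemma estimate_of_mem_frontier (hf : IsCurvatureFunction f K) (hu : IsLevelSetSolution f K Ω u)
    (hΩ : IsOpen Ω) (hΩb : Bornology.IsBounded Ω) (hδ : 0 < δ)
    (hA : ∀ x ∈ frontier Ω, AndrewsAt f K δ Ω x) (hx : x ∈ frontier Ω)
    (hxy : y ∉ Ω ∨ u x ≤ u y) : -2 * fderiv ℝ u x (y - x) ≤ ‖y - x‖ ^ 2 / δ := by
  have hy : y ∉ Ω := fun hy ↦ by
    have h1 := hxy.resolve_left (not_not.2 hy)
    have h2 := hu.neg_of_mem hf hΩ hΩb hy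
    rw [hu.boundary x hx] at h1
    linarith
  rw [← inner_gradient_left]
  by_cases hg : gradient u x = 0
  · rw [hg, inner_zero_left, mul_zero]
    positivity
  · exact (notMem_ball_iff hδ).1 fun h ↦
      hy (hu.ball_subset_of_andrewsAt hf hΩ hΩb hδ hx (hA x hx) hg h)

/-- The two-point estimate holds with some constant in place of `1 / δ`. For interior `x` it follows
from the Lipschitz bound of the gradient on the segment from `x` to `y`, or to the point where it
leaves `Ω`. -/
lemma exists_rough_estimate (hf : IsCurvatureFunction f K) (hu : IsLevelSetSolution f K Ω u)
    (hΩ : IsOpen Ω) (hΩb : Bornology.IsBounded Ω) (hδ : 0 < δ)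
    (hA : ∀ x ∈ frontier Ω, AndrewsAt f K δ Ω x) :
    ∃ C : ℝ, 0 < C ∧ ∀ x ∈ closure Ω, ∀ y, (y ∉ Ω ∨ u x ≤ u y) →
      -2 * fderiv ℝ u x (y - x) ≤ C * ‖y - x‖ ^ 2 := by
  obtain ⟨L, hL⟩ := hu.lipschitz
  have hL0 : (0 : ℝ) ≤ L := L.2
  refine ⟨2 * L + 1 / δ, by positivity, fun x hx y hxy ↦ ?_⟩
  by_cases hxΩ : x ∈ Ω
  swap
  · have h1 := hu.estimate_of_mem_frontier hf hΩ hΩb hδ hA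
      (by rw [hΩ.frontier_eq]; exact ⟨hx, hxΩ⟩) hxy
    have h2 : ‖y - x‖ ^ 2 / δ = 1 / δ * ‖y - x‖ ^ 2 := by ring
    nlinarith [sq_nonneg ‖y - x‖]
  -- The segment up to its first exit, or all of it.
  obtain ⟨τ, hτ0, hτ1, hseg, hval⟩ : ∃ τ : ℝ, 0 < τ ∧ τ ≤ 1 ∧
      segment ℝ x (x + τ • (y - x)) ⊆ closure Ω ∧ u x ≤ u (x + τ • (y - x)) := by
    have hsegeq : ∀ τ : ℝ, ∀ w ∈ segment ℝ x (x + τ • (y - x)),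
        ∃ r ∈ Set.Icc (0 : ℝ) 1, w = x + (r * τ) • (y - x) := by
      intro τ w hw
      rw [segment_eq_image'] at hw
      obtain ⟨r, hr, rfl⟩ := hw
      exact ⟨r, hr, by simp [mul_smul]⟩
    by_cases hall : ∀ r ∈ Set.Icc (0 : ℝ) 1, x + r • (y - x) ∈ Ω
    · refine ⟨1, one_pos, le_rfl, fun w hw ↦ ?_, ?_⟩
      · obtain ⟨r, hr, rfl⟩ := hsegeq 1 w hw
        rw [mul_one]
        exact subset_closure (hall r hr)
      · have hyΩ : y ∈ Ω := by simpa using hall 1 (by simp)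
        simpa using hxy.resolve_left (not_not.2 hyΩ)
    · push Not at hall
      obtain ⟨r₀, hr₀, hr₀Ω⟩ := hall
      obtain ⟨τ, hτ0, hτ1, hfr, hin⟩ := exists_first_exit hΩ hxΩ hr₀Ω
      simp only [add_sub_cancel_left, smul_smul] at hfr hin
      have hr₀' : 0 < r₀ := lt_of_le_of_ne hr₀.1 fun h ↦ hr₀Ω (by simpa [← h] using hxΩ)
      refine ⟨τ * r₀, by positivity, mul_le_one₀ hτ1 hr₀.1 hr₀.2, fun w hw ↦ ?_, ?_⟩
      · obtain ⟨r, hr, rfl⟩ := hsegeq _ w hw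
        rcases hr.2.lt_or_eq with h1 | rfl
        · rw [← mul_assoc]
          exact subset_closure (hin (r * τ) (mul_nonneg hr.1 hτ0.le) (by nlinarith))
        · rw [one_mul]
          exact frontier_subset_closure hfr
      · rw [hu.boundary _ hfr]
        exact (hu.neg_of_mem hf hΩ hΩb hxΩ).le
  obtain ⟨w, hw, hwe⟩ := domain_mvt
    (fun z hz ↦ (hu.differentiableAt z (hseg hz)).hasFDerivAt.hasFDerivWithinAt)
    (convex_segment x (x + τ • (y - x))) (left_mem_segment ℝ _ _) (right_mem_segment ℝ _ _)
  rw [add_sub_cancel_left, map_smul, smul_eq_mul] at hwe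
  have h1 : 0 ≤ fderiv ℝ u w (y - x) := by
    have : 0 ≤ τ * fderiv ℝ u w (y - x) := by rw [← hwe]; linarith
    exact nonneg_of_mul_nonneg_right this hτ0
  have hwx : ‖x - w‖ ≤ ‖y - x‖ := by
    rw [segment_eq_image'] at hw
    obtain ⟨r, hr, rfl⟩ := hw
    rw [add_sub_cancel_left, show x - (x + r • τ • (y - x)) = -((r * τ) • (y - x)) by
      rw [mul_smul]; abel, norm_neg, norm_smul, Real.norm_of_nonneg (mul_nonneg hr.1 hτ0.le)]
    exact mul_le_of_le_one_left (norm_nonneg _) (mul_le_one₀ hr.2 hτ0.le hτ1)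
  have h2 : inner ℝ (gradient u w - gradient u x) (y - x) ≤ L * ‖y - x‖ * ‖y - x‖ := by
    refine (real_inner_le_norm _ _).trans (mul_le_mul_of_nonneg_right ?_ (norm_nonneg _))
    have := hL.dist_le_mul w (hseg hw) x hx
    rw [dist_eq_norm, dist_eq_norm, norm_sub_rev w] at this
    exact this.trans (mul_le_mul_of_nonneg_left hwx hL0)
  rw [inner_sub_left, inner_gradient_left, inner_gradient_left] at h2
  have h3 : 0 ≤ 1 / δ * ‖y - x‖ ^ 2 := by positivity
  nlinarith

/-- The estimate with an exponent slightly smaller than the true one and with an additional term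
which increases with the arrival time `-u`. The exponent keeps a maximum of the two-point
quotient away from the diagonal, where `D²u` may be irregular, and the additional
term makes the maximum principle strict. -/
lemma perturbed_estimate (hf : IsCurvatureFunction f K) (hu : IsLevelSetSolution f K Ω u)
    (hΩ : IsOpen Ω) (hΩb : Bornology.IsBounded Ω) (hδ : 0 < δ)
    (hA : ∀ x ∈ frontier Ω, AndrewsAt f K δ Ω x) {G D ε : ℝ}
    (hG : ∀ x ∈ closure Ω, ‖gradient u x‖ ≤ G) (hD : 0 < D) (hGD : 2 * G * δ ≤ D) (hε : 0 < ε)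
    (hε1 : ε ≤ 1 / 10) (hx : x ∈ closure Ω) (hxy : y ∉ Ω ∨ u x ≤ u y) :
    -2 * fderiv ℝ u x (y - x) ≤
      ((D ^ 2) ^ ε / δ - ε * u x) * (‖y - x‖ ^ 2) ^ (1 - ε) := by
  by_contra! hcon
  set M₀ := (D ^ 2) ^ ε / δ with hM₀
  have hM₀pos : 0 < M₀ := by positivity
  obtain ⟨C, hC, hrough⟩ := hu.exists_rough_estimate hf hΩ hΩb hδ hA
  have hp : 0 < 1 - ε := by linarith
  let P : Set (Ambient n × Ambient n) := {v | v.1 ∈ closure Ω ∧ (v.2 ∉ Ω ∨ u v.1 ≤ u v.2)}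
  let Θ : Ambient n × Ambient n → ℝ := fun v ↦
    -2 * fderiv ℝ u v.1 (v.2 - v.1) / (‖v.2 - v.1‖ ^ 2) ^ (1 - ε) + ε * u v.1
  have hu0 : ∀ v ∈ P, ε * u v.1 ≤ 0 := fun v hv ↦
    mul_nonpos_of_nonneg_of_nonpos hε.le (hu.nonpos_of_mem_closure hf hΩ hΩb hv.1)
  -- A quadratic bound at distances where the constant is at most `M₀ s ^ (-ε)` gives `Θ ≤ M₀`.
  have hΘle : ∀ v ∈ P, v.2 ≠ v.1 → ∀ B, B * (‖v.2 - v.1‖ ^ 2) ^ ε ≤ M₀ →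
      -2 * fderiv ℝ u v.1 (v.2 - v.1) ≤ B * ‖v.2 - v.1‖ ^ 2 → Θ v ≤ M₀ := by
    intro v hv hne B hB h
    have hs : 0 < ‖v.2 - v.1‖ ^ 2 := pow_pos (norm_pos_iff.2 (sub_ne_zero.2 hne)) 2
    have h1 : -2 * fderiv ℝ u v.1 (v.2 - v.1) / (‖v.2 - v.1‖ ^ 2) ^ (1 - ε) ≤ M₀ := by
      rw [div_le_iff₀ (Real.rpow_pos_of_pos hs _)]
      refine h.trans ?_
      have h2 : ‖v.2 - v.1‖ ^ 2 = (‖v.2 - v.1‖ ^ 2) ^ ε * (‖v.2 - v.1‖ ^ 2) ^ (1 - ε) := by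
        rw [← Real.rpow_add hs, add_sub_cancel, Real.rpow_one]
      calc B * ‖v.2 - v.1‖ ^ 2
          = B * (‖v.2 - v.1‖ ^ 2) ^ ε * (‖v.2 - v.1‖ ^ 2) ^ (1 - ε) := by
            rw [mul_assoc, ← h2]
        _ ≤ _ := mul_le_mul_of_nonneg_right hB (by positivity)
    have h3 := hu0 v hv
    simp only [Θ]
    linarith
  set r := (M₀ / C) ^ (1 / ε) with hr
  have hrpos : 0 < r := Real.rpow_pos_of_pos (by positivity) _
  have hnear : ∀ v ∈ P, v.2 ≠ v.1 → ‖v.2 - v.1‖ ^ 2 < r → Θ v ≤ M₀ := by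
    intro v hv hne hlt
    refine hΘle v hv hne C ?_ (hrough v.1 hv.1 v.2 hv.2)
    have h1 : (‖v.2 - v.1‖ ^ 2) ^ ε ≤ r ^ ε := Real.rpow_le_rpow (by positivity) hlt.le hε.le
    rw [hr, ← Real.rpow_mul (by positivity), one_div_mul_cancel hε.ne', Real.rpow_one,
      le_div_iff₀ hC] at h1
    linarith
  have hfar : ∀ v ∈ P, v.2 ≠ v.1 → D < ‖v.2 - v.1‖ → Θ v ≤ M₀ := by
    intro v hv hne hlt
    have hs : 0 < ‖v.2 - v.1‖ := norm_pos_iff.2 (sub_ne_zero.2 hne)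
    refine hΘle v hv hne (M₀ / (‖v.2 - v.1‖ ^ 2) ^ ε) ?_ ?_
    · rw [div_mul_cancel₀]
      positivity
    · have h1 : -2 * fderiv ℝ u v.1 (v.2 - v.1) ≤ 2 * (G * ‖v.2 - v.1‖) := by
        rw [← inner_gradient_left]
        have h2 := (abs_le.1 (abs_real_inner_le_norm (gradient u v.1) (v.2 - v.1))).1
        have h3 := mul_le_mul_of_nonneg_right (hG v.1 hv.1) hs.le
        linarith
      refine h1.trans ?_
      -- As `D² / ‖z‖² ≤ 1` and `ε ≤ 1 / 2`, its power is at least `D / ‖z‖`, and `2 G ≤ D / δ`.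
      have h4 : (D ^ 2 / ‖v.2 - v.1‖ ^ 2) ^ (1 / 2 : ℝ) ≤ (D ^ 2 / ‖v.2 - v.1‖ ^ 2) ^ ε := by
        refine Real.rpow_le_rpow_of_exponent_ge (by positivity) ?_ (by linarith)
        rw [div_le_one (by positivity)]
        exact pow_le_pow_left₀ hD.le hlt.le 2
      rw [← div_pow, ← Real.sqrt_eq_rpow, Real.sqrt_sq (by positivity), div_pow,
        Real.div_rpow (by positivity) (by positivity)] at h4
      have h5 : M₀ / (‖v.2 - v.1‖ ^ 2) ^ ε = (D ^ 2) ^ ε / (‖v.2 - v.1‖ ^ 2) ^ ε / δ := by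
        rw [hM₀]
        ring
      rw [h5]
      have h6 : D / ‖v.2 - v.1‖ / δ * ‖v.2 - v.1‖ ^ 2 ≤
          (D ^ 2) ^ ε / (‖v.2 - v.1‖ ^ 2) ^ ε / δ * ‖v.2 - v.1‖ ^ 2 := by gcongr
      refine le_trans ?_ h6
      have h7 : D / ‖v.2 - v.1‖ / δ * ‖v.2 - v.1‖ ^ 2 = D / δ * ‖v.2 - v.1‖ := by
        field_simp
      rw [h7, ← mul_assoc]
      gcongr
      rw [le_div_iff₀ hδ]
      exact hGD
  have hbdry : ∀ v ∈ P, v.2 ≠ v.1 → v.1 ∉ Ω → ‖v.2 - v.1‖ ≤ D → Θ v ≤ M₀ := by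
    intro v hv hne hvΩ hle
    refine hΘle v hv hne (1 / δ) ?_ ?_
    · have : (‖v.2 - v.1‖ ^ 2) ^ ε ≤ (D ^ 2) ^ ε :=
        Real.rpow_le_rpow (by positivity) (pow_le_pow_left₀ (norm_nonneg _) hle 2) hε.le
      rw [hM₀, one_div_mul_eq_div]
      gcongr
    · rw [one_div_mul_eq_div]
      exact hu.estimate_of_mem_frontier hf hΩ hΩb hδ hA
        (by rw [hΩ.frontier_eq]; exact ⟨hv.1, hvΩ⟩) hv.2
  let Q : Set (Ambient n × Ambient n) := {v | v ∈ P ∧ r ≤ ‖v.2 - v.1‖ ^ 2 ∧ ‖v.2 - v.1‖ ≤ D}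
  have hQne : ∀ v ∈ Q, v.2 ≠ v.1 := fun v hv h ↦ by
    have := hv.2.1
    rw [h, sub_self, norm_zero] at this
    norm_num at this
    linarith
  have hQcomp : IsCompact Q := by
    obtain ⟨B, hB⟩ := hΩb.closure.subset_closedBall (0 : Ambient n)
    refine ((isCompact_closedBall (0 : Ambient n) B).prod
      (isCompact_closedBall (0 : Ambient n) (B + D))).of_isClosed_subset ?_ fun v hv ↦ ?_
    · refine isClosed_of_closure_subset fun v hv ↦ ?_
      obtain ⟨w, hwQ, hw⟩ := mem_closure_iff_seq_limit.1 hv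
      have hw1 : Tendsto (fun k ↦ (w k).1) atTop (𝓝 v.1) := (continuous_fst.tendsto v).comp hw
      have hw2 : Tendsto (fun k ↦ (w k).2) atTop (𝓝 v.2) := (continuous_snd.tendsto v).comp hw
      have hv1 : v.1 ∈ closure Ω :=
        isClosed_closure.mem_of_tendsto hw1 (Eventually.of_forall fun k ↦ (hwQ k).1.1)
      have hn := (hw2.sub hw1).norm
      refine ⟨⟨hv1, ?_⟩, ge_of_tendsto (hn.pow 2) (Eventually.of_forall fun k ↦ (hwQ k).2.1),
        le_of_tendsto hn (Eventually.of_forall fun k ↦ (hwQ k).2.2)⟩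
      by_contra! hvn
      have h1 := (hu.differentiableAt v.1 hv1).continuousAt.tendsto.comp hw1
      have h2 := (hu.differentiableAt v.2 (subset_closure hvn.1)).continuousAt.tendsto.comp hw2
      obtain ⟨k, hk1, hk2⟩ := ((h2.eventually_lt h1 hvn.2).and
        (hw2.eventually (hΩ.mem_nhds hvn.1))).exists
      exact absurd ((hwQ k).1.2.resolve_left (not_not.2 hk2)) (not_le.2 hk1)
    · have h1 := hB hv.1.1
      refine ⟨h1, ?_⟩
      rw [mem_closedBall_zero_iff] at h1 ⊢
      have h2 : v.2 = v.1 + (v.2 - v.1) := by abel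
      rw [h2]
      exact (norm_add_le _ _).trans (add_le_add h1 hv.2.2)
  have hΘcont : ContinuousOn Θ Q := by
    obtain ⟨L, hL⟩ := hu.lipschitz
    have hfst : Set.MapsTo Prod.fst Q (closure Ω) := fun v hv ↦ hv.1.1
    have h1 : ContinuousOn (fun v : Ambient n × Ambient n ↦ gradient u v.1) Q :=
      hL.continuousOn.comp continuousOn_fst hfst
    have h2 : ContinuousOn (fun v : Ambient n × Ambient n ↦ u v.1) Q :=
      hu.continuousOn.comp continuousOn_fst hfst
    have hz : ContinuousOn (fun v : Ambient n × Ambient n ↦ v.2 - v.1) Q :=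
      continuousOn_snd.sub continuousOn_fst
    have h3 : ContinuousOn (fun v : Ambient n × Ambient n ↦
        -2 * fderiv ℝ u v.1 (v.2 - v.1)) Q := by
      simp_rw [← inner_gradient_left]
      exact continuousOn_const.mul (h1.inner hz)
    have hpos : ∀ v ∈ Q, 0 < ‖v.2 - v.1‖ ^ 2 := fun v hv ↦ hrpos.trans_le hv.2.1
    refine (h3.div ((hz.norm.pow 2).rpow_const fun v hv ↦ Or.inl (hpos v hv).ne') fun v hv ↦
      (Real.rpow_pos_of_pos (hpos v hv) _).ne').add (continuousOn_const.mul h2)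
  -- The pair which violates the estimate lies in `Q`.
  have hvP : (x, y) ∈ P := ⟨hx, hxy⟩
  have hyx : y ≠ x := by
    rintro rfl
    simp [Real.zero_rpow hp.ne'] at hcon
  have hΘxy : M₀ < Θ (x, y) := by
    have hs : 0 < ‖y - x‖ ^ 2 := pow_pos (norm_pos_iff.2 (sub_ne_zero.2 hyx)) 2
    have := (lt_div_iff₀ (Real.rpow_pos_of_pos hs (1 - ε))).2 hcon
    simp only [Θ]
    linarith
  have hvQ : (x, y) ∈ Q := by
    refine ⟨hvP, not_lt.1 fun h ↦ ?_, not_lt.1 fun h ↦ ?_⟩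
    · exact absurd (hnear _ hvP hyx h) (not_le.2 hΘxy)
    · exact absurd (hfar _ hvP hyx h) (not_le.2 hΘxy)
  obtain ⟨v, hvQ', hvmax⟩ := hQcomp.exists_isMaxOn ⟨_, hvQ⟩ hΘcont
  have hM : M₀ < Θ v := hΘxy.trans_le (hvmax hvQ)
  have hglobal : ∀ w ∈ P, w.2 ≠ w.1 → Θ w ≤ Θ v := by
    intro w hw hne
    by_cases hwQ : w ∈ Q
    · exact hvmax hwQ
    · refine le_trans ?_ hM.le
      by_cases h1 : ‖w.2 - w.1‖ ^ 2 < r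
      · exact hnear w hw hne h1
      · exact hfar w hw hne (not_le.1 fun h2 ↦ hwQ ⟨hw, not_lt.1 h1, h2⟩)
  have hvΩ : v.1 ∈ Ω := by
    by_contra h
    exact absurd (hbdry v hvQ'.1 (hQne v hvQ') h hvQ'.2.2) (not_le.2 hM)
  have hs : 0 < ‖v.2 - v.1‖ ^ 2 := hrpos.trans_le hvQ'.2.1
  set s := ‖v.2 - v.1‖ ^ 2 with hsdef
  set T := s ^ (1 - ε) with hT
  have hTpos : 0 < T := Real.rpow_pos_of_pos hs _
  refine not_isTwoPointMax (x := v.1) (y := v.2) (M := Θ v * T) (τ := ε * T) (p := 1 - ε) (s := s)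
    hf hu hΩ hΩb (by positivity) (by linarith) (by linarith)
    { mem := hvΩ
      pair := hvQ'.1.2
      le_zero := ?_
      eq_zero := ?_
      sq_eq := rfl
      sq_pos := hs
      weight_pos := ?_ }
  · intro x' hx' y' hxy'
    have hx'c := subset_closure hx'
    have hweight : 0 < Θ v - ε * u x' := by
      have := hu0 (x', y') ⟨hx'c, hxy'⟩
      simp only at this
      linarith
    rw [twoPoint, show Θ v * T - ε * T * u x' = (Θ v - ε * u x') * T by ring]
    rcases eq_or_ne y' x' with rfl | hne
    · have : 0 ≤ (Θ v - ε * u y') * T * ε := by positivity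
      simpa using this
    · have h1 := hglobal (x', y') ⟨hx'c, hxy'⟩ hne
      have hs' : 0 < ‖y' - x'‖ ^ 2 := pow_pos (norm_pos_iff.2 (sub_ne_zero.2 hne)) 2
      simp only [Θ] at h1
      rw [← le_sub_iff_add_le, div_le_iff₀ (Real.rpow_pos_of_pos hs' _)] at h1
      -- Concavity: the power lies below its tangent line at `s`.
      have h2 : (‖y' - x'‖ ^ 2) ^ (1 - ε) ≤ T * (1 - (1 - ε) + (1 - ε) * (‖y' - x'‖ ^ 2 / s)) := by
        have h3 := rpow_one_add_le_one_add_mul_self (s := ‖y' - x'‖ ^ 2 / s - 1) (p := 1 - ε)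
          (by linarith [div_pos hs' hs]) hp.le (by linarith)
        rw [add_sub_cancel, Real.div_rpow hs'.le hs.le, ← hT, div_le_iff₀ hTpos] at h3
        linarith
      have h4 := h1.trans (mul_le_mul_of_nonneg_left h2 hweight.le)
      linarith
  · have h1 : Θ v = -2 * fderiv ℝ u v.1 (v.2 - v.1) / T + ε * u v.1 := rfl
    have h2 : (Θ v - ε * u v.1) * T = -2 * fderiv ℝ u v.1 (v.2 - v.1) := by
      rw [h1]
      field_simp
      ring
    rw [twoPoint, ← hsdef, div_self hs.ne']
    linarith
  · have := hu0 v hvQ'.1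
    have h1 : 0 < (Θ v - ε * u v.1) * T := mul_pos (by linarith) hTpos
    linarith

/-- The Andrews condition as an estimate for pairs of points. -/
lemma two_point_estimate (hf : IsCurvatureFunction f K) (hu : IsLevelSetSolution f K Ω u)
    (hΩ : IsOpen Ω) (hΩb : Bornology.IsBounded Ω) (hδ : 0 < δ)
    (hA : ∀ x ∈ frontier Ω, AndrewsAt f K δ Ω x) (hx : x ∈ Ω) (hxy : y ∉ Ω ∨ u x ≤ u y) :
    -2 * fderiv ℝ u x (y - x) ≤ ‖y - x‖ ^ 2 / δ := by
  rcases eq_or_ne y x with rfl | hne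
  · simp
  have hs : 0 < ‖y - x‖ ^ 2 := pow_pos (norm_pos_iff.2 (sub_ne_zero.2 hne)) 2
  obtain ⟨L, hL⟩ := hu.lipschitz
  obtain ⟨G, hG⟩ := hΩb.isCompact_closure.exists_bound_of_continuousOn hL.continuousOn
  have hG0 : 0 ≤ G := (norm_nonneg _).trans (hG x (subset_closure hx))
  have hD : 0 < 2 * G * δ + 1 := by positivity
  set D := 2 * G * δ + 1 with hDdef
  have hcont : ContinuousAt (fun ε : ℝ ↦
      ((D ^ 2) ^ ε / δ - ε * u x) * (‖y - x‖ ^ 2) ^ (1 - ε)) 0 := by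
    have h1 : ContinuousAt (fun ε : ℝ ↦ (D ^ 2) ^ ε) 0 :=
      continuousAt_const.rpow continuousAt_id (Or.inl (by positivity))
    have h2 : ContinuousAt (fun ε : ℝ ↦ (‖y - x‖ ^ 2) ^ (1 - ε)) 0 :=
      continuousAt_const.rpow (continuousAt_const.sub continuousAt_id) (Or.inl hs.ne')
    exact ((h1.div_const δ).sub (continuousAt_id.mul continuousAt_const)).mul h2
  have hlim := hcont.tendsto.mono_left (nhdsWithin_le_nhds (s := Set.Ioi 0))
  have := ge_of_tendsto hlim (b := -2 * fderiv ℝ u x (y - x)) (by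
    filter_upwards [Ioo_mem_nhdsGT (show (0 : ℝ) < 1 / 10 by norm_num)] with ε hε
    exact hu.perturbed_estimate hf hΩ hΩb hδ hA hG hD (by linarith) hε.1 hε.2.le
      (subset_closure hx) hxy)
  simpa [div_eq_inv_mul] using this

end IsLevelSetSolution

end GlobalEstimate

theorem mainTheorem2 {n : ℕ} (f : (Fin n → ℝ) → ℝ) (K : Set (Fin n → ℝ))
    (hf : IsCurvatureFunction f K)
    (Ω : Set (EuclideanSpace ℝ (Fin (n + 1)))) (hΩ : IsOpen Ω) (hΩb : Bornology.IsBounded Ω)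
    (u : EuclideanSpace ℝ (Fin (n + 1)) → ℝ) (hu : IsLevelSetSolution f K Ω u)
    (δ : ℝ) (hδ : 0 < δ) (hA : ∀ x ∈ frontier Ω, AndrewsAt f K δ Ω x) :
    ∀ t : ℝ, ∀ x ∈ Ω, u x = -t →
      (gradient u x ≠ 0 ∨ IsC2BoundaryPoint {y ∈ Ω | u y < -t} x) →
      AndrewsAt f K δ {y ∈ Ω | u y < -t} x := by
  intro t x hx hxt hxb
  have hg : gradient u x ≠ 0 := hxb.elim id
    (hu.gradient_ne_zero_of_isC2BoundaryPoint hf hΩ hx hxt)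
  have hfd : fderiv ℝ (fun y ↦ u y + t) = fderiv ℝ u := funext fun y ↦ fderiv_add_const t
  have hgr : gradient (fun y ↦ u y + t) = gradient u := by
    ext1 y
    rw [gradient, gradient, hfd]
  obtain ⟨κ, hκ, hκK, hκ1⟩ := hu.equation x hx hg
  have hpos : 0 < ‖gradient u x‖ := norm_pos_iff.2 hg
  refine ⟨fun y ↦ u y + t, ⟨?_, by simp [hxt], by rwa [hgr], ?_⟩, κ, ?_, hκK, ?_⟩
  · exact (hu.contDiffAt (subset_closure hx) hg 2).add contDiffAt_const
  · filter_upwards [hΩ.mem_nhds hx] with y hy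
    simp only [hy, true_and]
    constructor <;> intro h <;> linarith
  · rw [IsPrincipalCurvatures, hfd, hgr]
    exact hκ
  · have hr : δ / f κ = δ * ‖gradient u x‖ := by
      rw [div_eq_iff (hf.pos κ hκK).ne', mul_assoc, hκ1, mul_one]
    have hc : x + (δ * ‖gradient u x‖) • -(‖gradient u x‖⁻¹ • gradient u x) =
        x - δ • gradient u x := by
      rw [smul_neg, mul_smul, smul_inv_smul₀ hpos.ne', sub_eq_add_neg]
    rw [hgr, hr, hc]
    intro y hy
    by_contra hyU
    refine (notMem_ball_iff hδ).2 ?_ hy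
    rw [inner_gradient_left]
    refine hu.two_point_estimate hf hΩ hΩb hδ hA hx ?_
    by_cases hyΩ : y ∈ Ω
    · exact Or.inr (by rw [hxt]; exact not_lt.1 fun h ↦ hyU ⟨hyΩ, h⟩)
    · exact Or.inl hyΩ
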